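/- **Theorem 1.4.** For a closed convex cone $K\subset\mathbb{R}^n$ let $\Pi_K(v)=\arg\min_{\mu\in K}\|v-\mu\|$ be the metric projection onto $K$ and let $\delta(K)=\mathbb{E}\|\Pi_K(g)\|^2$, $g\sim\mathcal{N}(0,I_n)$, be its statistical dimension. There exists a universal constant $C>0$ such that the following holds for all positive integers $m,n$, all $x\in\mathbb{R}^n$ with $\|x\|=1$, all closed convex cones $K\subset\mathbb{R}^n$ with $K\neq\{0\}$, and all real $t\ge 1$. Let $G\in\mathbb{R}^{m\times n}$ have i.i.d. $\mathcal{N}(0,1)$ entries, let $b\in\mathbb{R}^m$ be deterministic, and consider the conic program $$\max_{\mu\in\mathbb{R}^n}\ \langle x,\mu\rangle\quad\text{subject to}\quad G\mu=b,\ \mu\in K .$$ The program is feasible if $\{\mu\in K:G\mu=b\}\neq\emptyset$ and infeasible otherwise; its value is $\sup\{\langle x,\mu\rangle:\mu\in K,\ G\mu=b\}\in[-\infty,\infty]$ (with $\sup\emptyset=-\infty$). Set $K_x=K\cap\{\mu\in\mathbb{R}^n:\langle x,\mu\rangle\ge 0\}$. * Homogeneous case $b=0$. 1. If $\sqrt m\ge\sqrt{\delta(K_x)}+C\sqrt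 t$, then with probability at least $1-e^{-t}$ the value of the program is $0$. 2. If $\sqrt m\le\sqrt{\delta(K_x)}-C\sqrt t$ and $\langle x,\mu\rangle>0$ for some $\mu\in K$, then with probability at least $1-e^{-t}$ the value of the program is $\infty$. * Inhomogeneous case $b\neq 0$. 1. If $\sqrt m\ge\sqrt{\delta(K)}+C\sqrt t$, then with probability at least $1-e^{-t}$ the program is infeasible. 2. If $\sqrt{\delta(K_x)}+C\sqrt t\le\sqrt m\le\sqrt{\delta(K)}-C\sqrt t$, then with probability at least $1-e^{-t}$ the program is feasible and its value is at most $0$. 3. If $\sqrt m\le\sqrt{\delta(K_x)}-C\sqrt t$ and $\langle x,\mu\rangle>0$ for some $\mu\in K$, then with probability at least $1-e^{-t}$ the value of the program is $\infty$. -/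

import Mathlib

open MeasureTheory ProbabilityTheory
open scoped Matrix

namespace ConicProgram

/-- The closed convex cone `K` has a point nearest to `v`. -/
theorem exists_nearest {n : ℕ} (K : ProperCone ℝ (EuclideanSpace ℝ (Fin n)))
    (v : EuclideanSpace ℝ (Fin n)) :
    ∃ p ∈ K, ∀ μ ∈ K, ‖v - p‖ ≤ ‖v - μ‖ := by
  have hne : (K : Set (EuclideanSpace ℝ (Fin n))).Nonempty := ⟨0, K.zero_mem⟩
  obtain ⟨p, hp, h⟩ := K.isClosed.exists_infDist_eq_dist hne v
  refine ⟨p, hp, fun μ hμ => ?_⟩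
  rw [← dist_eq_norm, ← dist_eq_norm, ← h]
  exact Metric.infDist_le_dist_of_mem hμ

/-- The metric projection `Π_K(v) = argmin_{μ ∈ K} ‖v - μ‖` onto a closed convex cone. The
minimizer exists by `exists_nearest` and is unique by `eq_proj`. -/
noncomputable def proj {n : ℕ} (K : ProperCone ℝ (EuclideanSpace ℝ (Fin n)))
    (v : EuclideanSpace ℝ (Fin n)) : EuclideanSpace ℝ (Fin n) :=
  (exists_nearest K v).choose

theorem proj_mem {n : ℕ} (K : ProperCone ℝ (EuclideanSpace ℝ (Fin n)))
    (v : EuclideanSpace ℝ (Fin n)) : proj K v ∈ K :=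
  (exists_nearest K v).choose_spec.1

theorem norm_sub_proj_le {n : ℕ} (K : ProperCone ℝ (EuclideanSpace ℝ (Fin n)))
    (v μ : EuclideanSpace ℝ (Fin n)) (hμ : μ ∈ K) : ‖v - proj K v‖ ≤ ‖v - μ‖ :=
  (exists_nearest K v).choose_spec.2 μ hμ

theorem eq_proj {n : ℕ} (K : ProperCone ℝ (EuclideanSpace ℝ (Fin n)))
    (v p : EuclideanSpace ℝ (Fin n)) (hp : p ∈ K) (h : ∀ μ ∈ K, ‖v - p‖ ≤ ‖v - μ‖) :
    p = proj K v := by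
  set q := proj K v with hq
  have hqK : q ∈ K := proj_mem K v
  have hpq : ‖v - p‖ = ‖v - q‖ := le_antisymm (h q hqK) (norm_sub_proj_le K v p hp)
  have hconv : Convex ℝ (K : Set (EuclideanSpace ℝ (Fin n))) := K.toPointedCone.convex
  have hmid : (1 / 2 : ℝ) • p + (1 / 2 : ℝ) • q ∈ K :=
    hconv hp hqK (by norm_num) (by norm_num) (by norm_num)
  have h1 := norm_sub_proj_le K v _ hmid
  have h2 : v - ((1 / 2 : ℝ) • p + (1 / 2 : ℝ) • q) = (1 / 2 : ℝ) • ((v - p) + (v - q)) := by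
    module
  rw [h2, norm_smul, ← hq] at h1
  have h3 := parallelogram_law_with_norm ℝ (v - p) (v - q)
  have h4 : ‖(v - p) - (v - q)‖ = ‖p - q‖ := by
    rw [sub_sub_sub_cancel_left, norm_sub_rev]
  rw [h4, hpq] at h3
  norm_num at h1
  have h5 : ‖p - q‖ = 0 := by
    nlinarith [norm_nonneg (p - q), norm_nonneg (v - q), norm_nonneg ((v - p) + (v - q))]
  exact sub_eq_zero.mp (norm_eq_zero.mp h5)

/-- The statistical dimension `δ(K) = 𝔼 ‖Π_K(g)‖²`, where `g ∼ N(0, I_n)`. -/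
noncomputable def statDim {n : ℕ} (K : ProperCone ℝ (EuclideanSpace ℝ (Fin n))) : ℝ :=
  ∫ g, ‖proj K g‖ ^ 2 ∂(stdGaussian (EuclideanSpace ℝ (Fin n)))

/-- The cone `K_x = K ∩ {μ : ⟨x, μ⟩ ≥ 0}`. -/
noncomputable def halfCone {n : ℕ} (K : ProperCone ℝ (EuclideanSpace ℝ (Fin n)))
    (x : EuclideanSpace ℝ (Fin n)) : ProperCone ℝ (EuclideanSpace ℝ (Fin n)) :=
  K ⊓ (ProperCone.positive ℝ ℝ).comap (innerSL ℝ x)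

theorem mem_halfCone {n : ℕ} (K : ProperCone ℝ (EuclideanSpace ℝ (Fin n)))
    (x μ : EuclideanSpace ℝ (Fin n)) : μ ∈ halfCone K x ↔ μ ∈ K ∧ 0 ≤ inner ℝ x μ := by
  simp [halfCone]

/-- A standard Gaussian matrix: a random matrix with i.i.d. `N(0,1)` entries. -/
structure IsStdGaussianMatrix {Ω : Type*} [MeasurableSpace Ω] (P : Measure Ω) {m n : ℕ}
    (G : Ω → Matrix (Fin m) (Fin n) ℝ) : Prop where
  hasLaw : ∀ i j, HasLaw (fun ω => G ω i j) (gaussianReal 0 1) P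
  indep : iIndepFun (fun (ij : Fin m × Fin n) ω => G ω ij.1 ij.2) P

/-- The constraint set `{μ ∈ K : A μ = b}` of the conic program. -/
def constraintSet {m n : ℕ} (K : ProperCone ℝ (EuclideanSpace ℝ (Fin n)))
    (A : Matrix (Fin m) (Fin n) ℝ) (b : Fin m → ℝ) : Set (EuclideanSpace ℝ (Fin n)) :=
  {μ | μ ∈ K ∧ A *ᵥ μ.ofLp = b}

/-- The conic program is feasible if its constraint set is non-empty. -/
def Feasible {m n : ℕ} (K : ProperCone ℝ (EuclideanSpace ℝ (Fin n)))
    (A : Matrix (Fin m) (Fin n) ℝ) (b : Fin m → ℝ) : Prop :=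
  (constraintSet K A b).Nonempty

/-- The value of `max ⟨x, μ⟩` subject to `A μ = b`, `μ ∈ K`: the supremum of the objective in the
extended reals (`⊤` if it is unbounded above, `⊥` if the program is infeasible). -/
noncomputable def value {m n : ℕ} (x : EuclideanSpace ℝ (Fin n))
    (K : ProperCone ℝ (EuclideanSpace ℝ (Fin n))) (A : Matrix (Fin m) (Fin n) ℝ)
    (b : Fin m → ℝ) : EReal :=
  ⨆ μ ∈ constraintSet K A b, ((inner ℝ x μ : ℝ) : EReal)

end ConicProgram

/-!
The exceptional events all have the form "some nonzero `u` in a cone `K₁` satisfies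
`⟪u, G v⟫ ≤ 0` for every `v` in a cone `K₂`", with `G` a standard Gaussian matrix, and such an
event is unlikely as soon as `√δ(K₂)` exceeds `√δ(K₁)` by a multiple of `√t`
(`IsStdGaussianMatrix.escape`).

* Taking for `K₂` the hyperplane orthogonal to `c`, whose statistical dimension is at least
  `m - 1`, and the transpose of `G`: if `√m` exceeds `√δ(K)`, then no nonzero vector of `K` is
  mapped into the line `ℝ c`. With `c = b` this shows that the program is infeasible, or,
  applied to `K_x`, that its value is not positive.
* Taking `K₁ = ℝᵐ` and `K₂ = K`: a cone `G K ≠ ℝᵐ` lies in a half-space, so if `√δ(K)` exceeds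
  `√m`, then `G K = ℝᵐ`. Applied to `K_x` and combined with a point of `K` of positive
  objective, this gives a direction of recession along which the objective tends to infinity.

The escape theorem rests on Gordon's comparison of the process `⟪u, G v⟫ + γ` with
`-⟪u, g⟫ + ⟪v, h⟫`, for unit vectors `u ∈ K₁`, `v ∈ K₂` (`gordon_bilinear`). As `γ ≤ 0` has
probability `1 / 2`, the exceptional event is at most about twice as likely as
`‖Π_{K₂} h‖ ≤ ‖Π_{K₁} g‖ + 3`, where the constant absorbs the finite nets and the smoothing; and
the two norms concentrate around `√δ(K₂)` and `√δ(K₁)`.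

Gordon's inequality (`gordon_comparison`) is obtained by Lindeberg replacement
(`HasTaylor.integral_le_integral`): centred Gaussian measures are convolutions of `N` dilated
copies of themselves, and exchanging the copies one at a time compares the means of a test
function by means of its Hessian alone. The test function is
`∏ i, (1 - ∏ j, cutoff (x (i, j)))`. Only uniform second order Taylor expansions are needed,
neither Gaussian integration by parts nor differentiation under the integral sign.

Concentration (`IsUnitSupport.hasSubgaussianMGF`) is the Maurey–Pisier argument for the
sublinear function `v ↦ ‖Π_K v‖`: `F y - F x` is split along a quarter turn from `x` to `y` into
small rotations, and convexity bounds each increment by its linearization, so that no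
differentiability is required.
-/

namespace ConicProgram

/-! ### Bounded functions with a second order Taylor expansion -/

section Taylor

variable {κ : Type*} [Fintype κ]

/-- `f` is bounded and has at every point a second order Taylor expansion, with gradient `D` and
Hessian matrix `H`, whose remainders of orders one, two and three are controlled uniformly. Stating
the three remainders separately makes the class closed under products without any recourse to
iterated derivatives. -/
def HasTaylor (f : (κ → ℝ) → ℝ) (D : (κ → ℝ) → κ → ℝ) (H : (κ → ℝ) → κ → κ → ℝ) : Prop :=
  ∃ C, 0 ≤ C ∧ ∀ x v : κ → ℝ,
    |f x| ≤ C ∧ |∑ k, D x k * v k| ≤ C * ‖v‖ ∧ |∑ k, ∑ l, H x k l * (v k * v l)| ≤ C * ‖v‖ ^ 2 ∧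
    |f (x + v) - f x| ≤ C * ‖v‖ ∧ |f (x + v) - f x - ∑ k, D x k * v k| ≤ C * ‖v‖ ^ 2 ∧
    |f (x + v) - f x - ∑ k, D x k * v k - (1 / 2) * ∑ k, ∑ l, H x k l * (v k * v l)|
      ≤ C * ‖v‖ ^ 3

theorem hasTaylor_const (c : ℝ) : HasTaylor (fun _ : κ → ℝ => c) (fun _ _ => 0)
    (fun _ _ _ => 0) := by
  refine ⟨|c|, abs_nonneg c, fun x v => ?_⟩
  simp only [zero_mul, Finset.sum_const_zero, abs_zero, sub_self, mul_zero, le_refl, true_and]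
  refine ⟨?_, ?_, ?_, ?_, ?_⟩ <;> positivity

theorem HasTaylor.const_sub {f : (κ → ℝ) → ℝ} {D H} (hf : HasTaylor f D H) (c : ℝ) :
    HasTaylor (fun x => c - f x) (fun x k => -D x k) (fun x k l => -H x k l) := by
  obtain ⟨C, hC, h⟩ := hf
  refine ⟨|c| + C, by positivity, fun x v => ?_⟩
  obtain ⟨h1, h2, h3, h4, h5, h6⟩ := h x v
  have hc : 0 ≤ |c| := abs_nonneg c
  have e0 : ∀ p : ℕ, C * ‖v‖ ^ p ≤ (|c| + C) * ‖v‖ ^ p := fun p => by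
    gcongr; linarith
  have e1 := e0 1
  rw [pow_one] at e1
  simp only [neg_mul, Finset.sum_neg_distrib]
  refine ⟨?_, ?_, ?_, ?_, ?_, ?_⟩
  · calc |c - f x| ≤ |c| + |f x| := abs_sub _ _
      _ ≤ _ := by linarith
  · rw [abs_neg]; linarith
  · rw [abs_neg]; linarith [e0 2]
  · rw [show c - f (x + v) - (c - f x) = -(f (x + v) - f x) by ring, abs_neg]; linarith
  · rw [show ∀ a : ℝ, c - f (x + v) - (c - f x) - -a = -(f (x + v) - f x - a) by intros; ring,
      abs_neg]
    linarith [e0 2]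
  · rw [show ∀ a b : ℝ, c - f (x + v) - (c - f x) - -a - 1 / 2 * -b
        = -(f (x + v) - f x - a - 1 / 2 * b) by intros; ring, abs_neg]
    linarith [e0 3]

/-- The Taylor remainders of a product, in terms of those of the factors: `y`, `z` are the values,
`a`, `b` the linear parts and `q`, `p` the quadratic parts of the two factors, `y'`, `z'` the values
at the displaced point and `s` the length of the displacement. -/
theorem abs_taylor_mul_le {C s y z y' z' a b q p : ℝ} (hy : |y| ≤ C) (hz : |z| ≤ C)
    (hz' : |z'| ≤ C) (ha : |a| ≤ C * s) (hb : |b| ≤ C * s) (hq : |q| ≤ C * s ^ 2)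
    (hp : |p| ≤ C * s ^ 2) (hf1 : |y' - y| ≤ C * s) (hg1 : |z' - z| ≤ C * s)
    (hf2 : |y' - y - a| ≤ C * s ^ 2) (hg2 : |z' - z - b| ≤ C * s ^ 2)
    (hf3 : |y' - y - a - 1 / 2 * q| ≤ C * s ^ 3) (hg3 : |z' - z - b - 1 / 2 * p| ≤ C * s ^ 3)
    (hs : 0 ≤ s) :
    |y * z| ≤ 4 * C ^ 2 ∧ |y * b + z * a| ≤ 4 * C ^ 2 * s ∧
    |y * p + z * q + 2 * (a * b)| ≤ 4 * C ^ 2 * s ^ 2 ∧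
    |y' * z' - y * z| ≤ 4 * C ^ 2 * s ∧
    |y' * z' - y * z - (y * b + z * a)| ≤ 4 * C ^ 2 * s ^ 2 ∧
    |y' * z' - y * z - (y * b + z * a) - 1 / 2 * (y * p + z * q + 2 * (a * b))|
      ≤ 4 * C ^ 2 * s ^ 3 := by
  have P : ∀ {a b A B : ℝ}, |a| ≤ A → |b| ≤ B → |a * b| ≤ A * B := fun {a b A B} ha hb => by
    rw [abs_mul]; exact mul_le_mul ha hb (abs_nonneg _) ((abs_nonneg _).trans ha)
  have hs3 : 0 ≤ C ^ 2 * s ^ 3 := by positivity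
  have hs2 : 0 ≤ C ^ 2 * s ^ 2 := by positivity
  have hs1 : 0 ≤ C ^ 2 * s := by positivity
  have hs0 : 0 ≤ C ^ 2 := by positivity
  refine ⟨?_, ?_, ?_, ?_, ?_, ?_⟩
  · refine (P hy hz).trans ?_
    linarith
  · refine (abs_add_le _ _).trans ((add_le_add (P hy hb) (P hz ha)).trans ?_)
    linarith
  · refine (abs_add_le _ _).trans ((add_le_add ((abs_add_le _ _).trans
      (add_le_add (P hy hp) (P hz hq))) (P (abs_two.le) (P ha hb))).trans (le_of_eq ?_))
    ring
  · rw [show y' * z' - y * z = (y' - y) * z' + y * (z' - z) by ring]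
    refine (abs_add_le _ _).trans ((add_le_add (P hf1 hz') (P hy hg1)).trans ?_)
    linarith
  · rw [show y' * z' - y * z - (y * b + z * a)
      = (y' - y - a) * z' + y * (z' - z - b) + a * (z' - z) by ring]
    refine (abs_add_le _ _).trans ((add_le_add ((abs_add_le _ _).trans
      (add_le_add (P hf2 hz') (P hy hg2))) (P ha hg1)).trans ?_)
    linarith
  · rw [show y' * z' - y * z - (y * b + z * a) - 1 / 2 * (y * p + z * q + 2 * (a * b))
      = (y' - y - a - 1 / 2 * q) * z' + y * (z' - z - b - 1 / 2 * p) + a * (z' - z - b)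
        + (1 / 2) * (q * (z' - z)) by ring]
    have hh : |(1 / 2 : ℝ)| ≤ 1 := by norm_num [abs_le]
    refine (abs_add_le _ _).trans ((add_le_add ((abs_add_le _ _).trans
      (add_le_add ((abs_add_le _ _).trans (add_le_add (P hf3 hz') (P hy hg3))) (P ha hg2)))
      (P hh (P hq hg1))).trans (le_of_eq ?_))
    ring

theorem HasTaylor.exists_forall_bound {f : (κ → ℝ) → ℝ} {D H} (hf : HasTaylor f D H) :
    ∃ C₀, ∀ C, C₀ ≤ C → ∀ x v : κ → ℝ,
      |f x| ≤ C ∧ |∑ k, D x k * v k| ≤ C * ‖v‖ ∧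
      |∑ k, ∑ l, H x k l * (v k * v l)| ≤ C * ‖v‖ ^ 2 ∧
      |f (x + v) - f x| ≤ C * ‖v‖ ∧ |f (x + v) - f x - ∑ k, D x k * v k| ≤ C * ‖v‖ ^ 2 ∧
      |f (x + v) - f x - ∑ k, D x k * v k - (1 / 2) * ∑ k, ∑ l, H x k l * (v k * v l)|
        ≤ C * ‖v‖ ^ 3 := by
  obtain ⟨C₀, -, h⟩ := hf
  refine ⟨C₀, fun C hC x v => ?_⟩
  obtain ⟨h1, h2, h3, h4, h5, h6⟩ := h x v
  have l1 : C₀ * ‖v‖ ≤ C * ‖v‖ := by gcongr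
  have l2 : C₀ * ‖v‖ ^ 2 ≤ C * ‖v‖ ^ 2 := by gcongr
  have l3 : C₀ * ‖v‖ ^ 3 ≤ C * ‖v‖ ^ 3 := by gcongr
  exact ⟨h1.trans hC, h2.trans l1, h3.trans l2, h4.trans l1, h5.trans l2, h6.trans l3⟩

theorem HasTaylor.mul {f g : (κ → ℝ) → ℝ} {Df Dg Hf Hg} (hf : HasTaylor f Df Hf)
    (hg : HasTaylor g Dg Hg) :
    HasTaylor (fun x => f x * g x) (fun x k => f x * Dg x k + g x * Df x k)
      (fun x k l => f x * Hg x k l + g x * Hf x k l + (Df x k * Dg x l + Dg x k * Df x l)) := by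
  obtain ⟨C₁, h⟩ := hf.exists_forall_bound
  obtain ⟨C₂, h'⟩ := hg.exists_forall_bound
  refine ⟨4 * max C₁ C₂ ^ 2, by positivity, fun x v => ?_⟩
  obtain ⟨f1, f2, f3, f4, f5, f6⟩ := h _ (le_max_left C₁ C₂) x v
  obtain ⟨g1, g2, g3, g4, g5, g6⟩ := h' _ (le_max_right C₁ C₂) x v
  have hlin : ∑ k, (f x * Dg x k + g x * Df x k) * v k
      = f x * ∑ k, Dg x k * v k + g x * ∑ k, Df x k * v k := by
    simp only [Finset.mul_sum, ← Finset.sum_add_distrib]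
    exact Finset.sum_congr rfl fun k _ => by ring
  have hquad : ∑ k, ∑ l, (f x * Hg x k l + g x * Hf x k l
        + (Df x k * Dg x l + Dg x k * Df x l)) * (v k * v l)
      = f x * ∑ k, ∑ l, Hg x k l * (v k * v l) + g x * ∑ k, ∑ l, Hf x k l * (v k * v l)
        + 2 * ((∑ k, Df x k * v k) * ∑ k, Dg x k * v k) := by
    have e : 2 * ((∑ k, Df x k * v k) * ∑ k, Dg x k * v k)
        = (∑ k, Df x k * v k) * (∑ k, Dg x k * v k)
          + (∑ k, Dg x k * v k) * (∑ k, Df x k * v k) := by ring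
    rw [e, Finset.sum_mul_sum, Finset.sum_mul_sum]
    simp only [Finset.mul_sum, ← Finset.sum_add_distrib]
    exact Finset.sum_congr rfl fun k _ => Finset.sum_congr rfl fun l _ => by ring
  rw [hlin, hquad]
  exact abs_taylor_mul_le f1 g1 (h' _ (le_max_right C₁ C₂) (x + v) v).1 f2 g2 f3 g3 f4 g4 f5 g5
    f6 g6 (norm_nonneg v)

/-- A three times continuously differentiable function of one variable, bounded together with its
derivatives, has a Taylor expansion as a function of a single coordinate. -/
theorem hasTaylor_coord {τ : ℝ → ℝ} (hτ : ContDiff ℝ 3 τ) {M : ℝ}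
    (hM : ∀ x, |τ x| ≤ M ∧ |deriv τ x| ≤ M ∧ |iteratedDeriv 2 τ x| ≤ M ∧
      |iteratedDeriv 3 τ x| ≤ M) [DecidableEq κ] (i : κ) :
    HasTaylor (fun x => τ (x i)) (fun x k => if k = i then deriv τ (x i) else 0)
      (fun x k l => if k = i ∧ l = i then iteratedDeriv 2 τ (x i) else 0) := by
  have hM0 : 0 ≤ M := (abs_nonneg _).trans (hM 0).1
  -- Lagrange form of the remainder at order `n + 1`
  have key : ∀ n : ℕ, n + 1 ≤ 3 → ∀ x s : ℝ, (∀ y, |iteratedDeriv (n + 1) τ y| ≤ M) →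
      |τ (x + s) - ∑ j ∈ Finset.range (n + 1), iteratedDeriv j τ x * s ^ j / j.factorial|
        ≤ M * |s| ^ (n + 1) := by
    intro n hn x s hb
    rcases eq_or_ne s 0 with rfl | hs
    · rw [Finset.sum_range_succ']
      simp
    have hne : x ≠ x + s := by simpa using hs
    have hτn : ContDiff ℝ (n + 1) τ := hτ.of_le (by exact_mod_cast hn)
    obtain ⟨y, -, hy⟩ := taylor_mean_remainder_lagrange_iteratedDeriv hne
      (hτn.contDiffOn (s := Set.uIcc x (x + s)))
    have hT : taylorWithinEval τ n (Set.uIcc x (x + s)) x (x + s)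
        = ∑ j ∈ Finset.range (n + 1), iteratedDeriv j τ x * s ^ j / j.factorial := by
      rw [taylor_within_apply]
      refine Finset.sum_congr rfl fun j hj => ?_
      have hj' : j ≤ n := Nat.lt_succ_iff.mp (Finset.mem_range.mp hj)
      rw [iteratedDerivWithin_eq_iteratedDeriv (uniqueDiffOn_uIcc hne)
        ((hτn.of_le (by exact_mod_cast Nat.le_succ_of_le hj')).contDiffAt) Set.left_mem_uIcc]
      rw [add_sub_cancel_left, smul_eq_mul]
      ring
    rw [← hT, hy, add_sub_cancel_left, abs_div, abs_mul, abs_pow]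
    rw [div_le_iff₀ (by positivity)]
    have h1 : (1 : ℝ) ≤ |((n + 1).factorial : ℝ)| := by
      rw [Nat.abs_cast]; exact_mod_cast Nat.succ_le_of_lt (Nat.factorial_pos _)
    calc |iteratedDeriv (n + 1) τ y| * |s| ^ (n + 1) ≤ M * |s| ^ (n + 1) * 1 := by
          rw [mul_one]; gcongr; exact hb y
      _ ≤ _ := by gcongr
  refine ⟨M, hM0, fun x v => ?_⟩
  have hv : |v i| ≤ ‖v‖ := norm_le_pi_norm v i
  have hlin : ∑ k, (if k = i then deriv τ (x i) else 0) * v k = deriv τ (x i) * v i := by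
    simp
  have hquad : ∑ k, ∑ l, (if k = i ∧ l = i then iteratedDeriv 2 τ (x i) else 0) * (v k * v l)
      = iteratedDeriv 2 τ (x i) * v i ^ 2 := by
    rw [Finset.sum_eq_single i (fun k _ hk => by simp [hk]) (by simp),
      Finset.sum_eq_single i (fun k _ hk => by simp [hk]) (by simp)]
    simp [sq]
  rw [hlin, hquad]
  obtain ⟨m0, m1, m2, m3⟩ := hM (x i)
  have k0 := key 0 (by norm_num) (x i) (v i) (fun y => by
    simpa [iteratedDeriv_one] using (hM y).2.1)
  have k1 := key 1 (by norm_num) (x i) (v i) (fun y => (hM y).2.2.1)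
  have k2 := key 2 (by norm_num) (x i) (v i) (fun y => (hM y).2.2.2)
  simp only [Finset.sum_range_succ, Finset.range_zero, Finset.sum_empty, iteratedDeriv_zero,
    iteratedDeriv_one, Nat.factorial, pow_zero, pow_one, zero_add] at k0 k1 k2
  norm_num at k0 k1 k2
  have e1 : M * |v i| ≤ M * ‖v‖ := by gcongr
  have e2 : M * v i ^ 2 ≤ M * ‖v‖ ^ 2 := by rw [← sq_abs]; gcongr
  have e3 : M * |v i| ^ 3 ≤ M * ‖v‖ ^ 3 := by gcongr
  simp only [Pi.add_apply]
  refine ⟨m0, ?_, ?_, k0.trans e1, ?_, ?_⟩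
  · rw [abs_mul]; exact (mul_le_mul_of_nonneg_right m1 (abs_nonneg _)).trans e1
  · rw [abs_mul, abs_of_nonneg (sq_nonneg (v i))]
    exact (mul_le_mul_of_nonneg_right m2 (sq_nonneg _)).trans e2
  · rw [sub_sub]; exact k1.trans e2
  · refine le_trans (le_of_eq ?_) (k2.trans e3)
    congr 1; ring

theorem HasTaylor.continuous {f : (κ → ℝ) → ℝ} {D H} (hf : HasTaylor f D H) : Continuous f := by
  obtain ⟨C, hC, h⟩ := hf
  refine LipschitzWith.continuous (K := C.toNNReal) (LipschitzWith.of_dist_le_mul fun x y => ?_)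
  have := (h y (x - y)).2.2.2.1
  rwa [add_sub_cancel, ← dist_eq_norm, ← Real.dist_eq, ← Real.coe_toNNReal C hC] at this

end Taylor

/-! ### Comparison of centred Gaussian measures by Lindeberg replacement -/

section Lindeberg

/-- Centred Gaussian measures form a convolution semigroup under dilation. -/
theorem conv_map_smul {E : Type*} [NormedAddCommGroup E] [NormedSpace ℝ E] [MeasurableSpace E]
    [BorelSpace E] [SecondCountableTopology E] [CompleteSpace E] (μ : Measure E) [IsGaussian μ]
    (hμ : μ[id] = 0) (a b : ℝ) :
    μ.map (fun x => a • x) ∗ μ.map (fun x => b • x) = μ.map (fun x => √(a ^ 2 + b ^ 2) • x) := by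
  have key : ∀ (c : ℝ) (L : StrongDual ℝ E), charFunDual (μ.map (fun x => c • x)) L
      = Complex.exp (-(c ^ 2 * Var[L; μ] : ℝ) / 2) := by
    intro c L
    have : (fun x : E => c • x) = ⇑(c • ContinuousLinearMap.id ℝ E) := by ext; simp
    rw [this, charFunDual_map, IsGaussian.charFunDual_eq_of_integral_eq_zero hμ]
    have h2 : ⇑(L.comp (c • ContinuousLinearMap.id ℝ E)) = fun x => c * L x := by
      ext; simp
    rw [h2, variance_const_mul]
  have : ∀ c : ℝ, IsFiniteMeasure (μ.map (fun x => c • x)) := fun c => inferInstance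
  refine Measure.ext_of_charFunDual ?_
  ext L
  rw [charFunDual_conv, key, key, key, ← Complex.exp_add, Real.sq_sqrt (by positivity)]
  congr 1
  push_cast
  ring

variable {κ : Type*} [Fintype κ] {f : (κ → ℝ) → ℝ} {D : (κ → ℝ) → κ → ℝ}
  {H : (κ → ℝ) → κ → κ → ℝ} {μ ν : Measure (κ → ℝ)} [IsGaussian μ] [IsGaussian ν]

theorem integrable_coord (k : κ) : Integrable (fun v : κ → ℝ => v k) μ :=
  IsGaussian.integrable_dual μ (ContinuousLinearMap.proj (R := ℝ) k)

theorem integrable_coord_mul (k l : κ) : Integrable (fun v : κ → ℝ => v k * v l) μ :=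
  (IsGaussian.memLp_dual μ (ContinuousLinearMap.proj (R := ℝ) k) 2 (by simp)).integrable_mul
    (IsGaussian.memLp_dual μ (ContinuousLinearMap.proj (R := ℝ) l) 2 (by simp))

theorem integral_coord (hμ : μ[id] = 0) (k : κ) : ∫ v, v k ∂μ = 0 := by
  have h := IsGaussian.integral_dual (μ := μ) (ContinuousLinearMap.proj (R := ℝ) k)
  have h0 : ∫ x, x ∂μ = 0 := hμ
  rw [h0, map_zero] at h
  exact h

/-- Averaging a function with a Taylor expansion over a small centred Gaussian displacement: the
linear term disappears and the quadratic one only sees the covariance. -/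
theorem HasTaylor.abs_integral_sub_le (hf : HasTaylor f D H) (hμ : μ[id] = 0) :
    ∃ B, 0 ≤ B ∧ ∀ (x : κ → ℝ) (s : ℝ), 0 ≤ s →
      |∫ v, f (x + v) ∂(μ.map (fun v => s • v)) - f x
        - s ^ 2 / 2 * ∑ k, ∑ l, H x k l * ∫ v, v k * v l ∂μ| ≤ B * s ^ 3 := by
  have hcont := hf.continuous
  obtain ⟨C, hC, h⟩ := hf
  have h3 : Integrable (fun v : κ → ℝ => ‖v‖ ^ 3) μ := by
    have := (IsGaussian.memLp_id μ 3 (by simp)).integrable_norm_pow (by norm_num)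
    simpa using this
  refine ⟨C * ∫ v, ‖v‖ ^ 3 ∂μ, by positivity, fun x s hs => ?_⟩
  have hmap : ∫ v, f (x + v) ∂(μ.map (fun v => s • v)) = ∫ v, f (x + s • v) ∂μ :=
    integral_map (by fun_prop) (by fun_prop)
  have hint : Integrable (fun v => f (x + s • v)) μ := by
    refine (integrable_const C).mono' (by fun_prop) (ae_of_all _ fun v => ?_)
    exact (h (x + s • v) 0).1
  have hlinI : Integrable (fun v : κ → ℝ => ∑ k, D x k * (s * v k)) μ :=
    integrable_finsetSum _ fun k _ => ((integrable_coord k).const_mul s).const_mul _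
  have hquadI : Integrable (fun v : κ → ℝ => ∑ k, ∑ l, H x k l * (s * v k * (s * v l))) μ := by
    refine integrable_finsetSum _ fun k _ => integrable_finsetSum _ fun l _ => ?_
    refine (((integrable_coord_mul (μ := μ) k l).const_mul (s ^ 2)).const_mul (H x k l)).congr
      (ae_of_all _ fun v => ?_)
    simp only; ring
  have hlin : ∫ v, ∑ k, D x k * (s * v k) ∂μ = 0 := by
    rw [integral_finsetSum _ fun k _ => ((integrable_coord k).const_mul s).const_mul _]
    simp [integral_const_mul, integral_coord hμ]
  have hquad : ∫ v, ∑ k, ∑ l, H x k l * (s * v k * (s * v l)) ∂μ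
      = s ^ 2 * ∑ k, ∑ l, H x k l * ∫ v, v k * v l ∂μ := by
    have e : ∀ k l (v : κ → ℝ), H x k l * (s * v k * (s * v l))
        = (s ^ 2 * H x k l) * (v k * v l) := fun k l v => by ring
    simp only [e]
    rw [integral_finsetSum _ fun k _ => integrable_finsetSum _ fun l _ =>
      (integrable_coord_mul k l).const_mul _]
    rw [Finset.mul_sum]
    refine Finset.sum_congr rfl fun k _ => ?_
    rw [integral_finsetSum _ fun l _ => (integrable_coord_mul k l).const_mul _, Finset.mul_sum]
    refine Finset.sum_congr rfl fun l _ => ?_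
    rw [integral_const_mul]; ring
  have hrem : ∫ v, f (x + v) ∂(μ.map (fun v => s • v)) - f x
        - s ^ 2 / 2 * ∑ k, ∑ l, H x k l * ∫ v, v k * v l ∂μ
      = ∫ v, (f (x + s • v) - f x - ∑ k, D x k * (s * v k)
          - 1 / 2 * ∑ k, ∑ l, H x k l * (s * v k * (s * v l))) ∂μ := by
    have i1 : Integrable (fun v => f (x + s • v) - f x) μ := hint.sub (integrable_const _)
    have i2 : Integrable (fun v => f (x + s • v) - f x - ∑ k, D x k * (s * v k)) μ :=
      i1.sub hlinI
    rw [integral_sub i2 (hquadI.const_mul _), integral_sub i1 hlinI,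
      integral_sub hint (integrable_const _), integral_const_mul, hlin, hquad, hmap]
    simp
    ring
  rw [hrem]
  refine (abs_integral_le_integral_abs).trans ?_
  have hle : ∀ v : κ → ℝ, |f (x + s • v) - f x - ∑ k, D x k * (s * v k)
          - 1 / 2 * ∑ k, ∑ l, H x k l * (s * v k * (s * v l))| ≤ C * s ^ 3 * ‖v‖ ^ 3 := by
    intro v
    have := (h x (s • v)).2.2.2.2.2
    rw [norm_smul, Real.norm_of_nonneg hs, mul_pow, ← mul_assoc] at this
    simpa using this
  refine (integral_mono_of_nonneg (ae_of_all _ fun v => abs_nonneg _) (h3.const_mul (C * s ^ 3))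
    (ae_of_all _ hle)).trans (le_of_eq ?_)
  rw [integral_const_mul]
  ring

/-- **Lindeberg replacement.** If at every point the Hessian of `f` has a larger pairing with the
covariance of `μ` than with that of `ν`, then `f` has a larger mean under `μ`. Both measures are
`N`-fold convolutions of their `1 / √N` dilations, and exchanging one factor changes the mean by at
least `-B * N ^ (-3 / 2)`. -/
theorem HasTaylor.integral_le_integral (hf : HasTaylor f D H) (hμ : μ[id] = 0) (hν : ν[id] = 0)
    (hH : ∀ x, ∑ k, ∑ l, H x k l * ∫ v, v k * v l ∂ν ≤ ∑ k, ∑ l, H x k l * ∫ v, v k * v l ∂μ) :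
    ∫ x, f x ∂ν ≤ ∫ x, f x ∂μ := by
  obtain ⟨B₁, hB₁, h₁⟩ := hf.abs_integral_sub_le hμ
  obtain ⟨B₂, hB₂, h₂⟩ := hf.abs_integral_sub_le hν
  have hcont := hf.continuous
  obtain ⟨C, hC⟩ : ∃ C, ∀ x, |f x| ≤ C := by
    obtain ⟨C, -, h⟩ := hf
    exact ⟨C, fun x => (h x 0).1⟩
  set B := B₁ + B₂ with hB
  have hfin : ∀ c : ℝ, IsProbabilityMeasure (μ.map (fun v => c • v)) := fun c =>
    Measure.isProbabilityMeasure_map (by fun_prop)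
  have hfin' : ∀ c : ℝ, IsProbabilityMeasure (ν.map (fun v => c • v)) := fun c =>
    Measure.isProbabilityMeasure_map (by fun_prop)
  have hI : ∀ (ρ : Measure (κ → ℝ)) [IsFiniteMeasure ρ], Integrable f ρ := fun ρ _ =>
    (integrable_const C).mono' (by fun_prop) (ae_of_all _ hC)
  let ψ : ℝ → ℝ → ℝ := fun a b => ∫ x, f x ∂((μ.map fun v => a • v) ∗ (ν.map fun v => b • v))
  have step : ∀ a b s : ℝ, 0 ≤ s →
      ψ a √(b ^ 2 + s ^ 2) - B * s ^ 3 ≤ ψ √(a ^ 2 + s ^ 2) b := by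
    intro a b s hs
    set ρ := (μ.map fun v => a • v) ∗ (ν.map fun v => b • v) with hρ
    have e1 : ψ √(a ^ 2 + s ^ 2) b = ∫ x, ∫ v, f (x + v) ∂(μ.map fun v => s • v) ∂ρ := by
      simp only [ψ]
      rw [← conv_map_smul μ hμ, Measure.conv_assoc,
        Measure.conv_comm (μ.map fun v => s • v), ← Measure.conv_assoc, integral_conv (hI _)]
    have e2 : ψ a √(b ^ 2 + s ^ 2) = ∫ x, ∫ v, f (x + v) ∂(ν.map fun v => s • v) ∂ρ := by
      simp only [ψ]
      rw [← conv_map_smul ν hν, ← Measure.conv_assoc, integral_conv (hI _)]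
    have hIin : ∀ (τ : Measure (κ → ℝ)) [IsProbabilityMeasure τ],
        Integrable (fun x => ∫ v, f (x + v) ∂τ) ρ := by
      intro τ _
      refine (integrable_const C).mono' ?_ (ae_of_all _ fun x => ?_)
      · exact (StronglyMeasurable.integral_prod_right (f := fun x v => f (x + v))
          (hcont.comp (by fun_prop)).stronglyMeasurable).aestronglyMeasurable
      · refine (norm_integral_le_of_norm_le_const (ae_of_all _ fun v => hC (x + v))).trans ?_
        simp
    rw [e1, e2]
    have : ∫ x, (∫ v, f (x + v) ∂(ν.map fun v => s • v) - B * s ^ 3) ∂ρ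
        ≤ ∫ x, ∫ v, f (x + v) ∂(μ.map fun v => s • v) ∂ρ := by
      refine integral_mono ((hIin _).sub (integrable_const _)) (hIin _) fun x => ?_
      have a1 := abs_le.mp (h₁ x s hs)
      have a2 := abs_le.mp (h₂ x s hs)
      have a3 := mul_le_mul_of_nonneg_left (hH x) (show 0 ≤ s ^ 2 / 2 by positivity)
      simp only [hB]
      nlinarith [a1.1, a2.2]
    rw [integral_sub (hIin _) (integrable_const _)] at this
    simpa using this
  have main : ∀ N : ℕ, 0 < N → ∫ x, f x ∂ν - B * (√N)⁻¹ ≤ ∫ x, f x ∂μ := by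
    intro N hN
    have hN' : (0 : ℝ) < N := by exact_mod_cast hN
    have tel : ∀ j : ℕ, j ≤ N →
        ψ 0 1 - j * (B * √(1 / N) ^ 3) ≤ ψ √(j / N) √((N - j : ℝ) / N) := by
      intro j
      induction j with
      | zero => intro _; simp [div_self hN'.ne']
      | succ j ih =>
        intro hj
        have hj' : (j : ℝ) + 1 ≤ N := by exact_mod_cast hj
        have h0 : (0 : ℝ) ≤ (N - (j + 1 : ℕ) : ℝ) / N := by
          push_cast
          exact div_nonneg (by linarith) hN'.le
        have := step √(j / N) √((N - (j + 1 : ℕ) : ℝ) / N) √(1 / N) (Real.sqrt_nonneg _)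
        rw [Real.sq_sqrt h0, Real.sq_sqrt (show (0 : ℝ) ≤ 1 / N by positivity),
          Real.sq_sqrt (show (0 : ℝ) ≤ j / N by positivity)] at this
        have e3 : (j / N : ℝ) + 1 / N = ((j + 1 : ℕ) : ℝ) / N := by push_cast; ring
        have e4 : (N - (j + 1 : ℕ) : ℝ) / N + 1 / N = (N - j : ℝ) / N := by push_cast; ring
        rw [e3, e4] at this
        have ih' := ih (Nat.le_of_succ_le hj)
        push_cast at this ih' ⊢
        linarith
    have h0 : ψ 0 1 = ∫ x, f x ∂ν := by
      simp only [ψ, zero_smul, one_smul, Measure.map_id']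
      rw [Measure.map_const, measure_univ, one_smul, Measure.dirac_zero_conv]
    have h1 : ψ 1 0 = ∫ x, f x ∂μ := by
      simp only [ψ, zero_smul, one_smul, Measure.map_id']
      rw [Measure.map_const, measure_univ, one_smul, Measure.conv_dirac_zero]
    have := tel N le_rfl
    rw [div_self hN'.ne', sub_self, zero_div, Real.sqrt_one, Real.sqrt_zero, h0, h1] at this
    have e : (N : ℝ) * (B * √(1 / N) ^ 3) = B * (√N)⁻¹ := by
      have hs : √(N : ℝ) ^ 2 = N := Real.sq_sqrt hN'.le
      have hs0 : √(N : ℝ) ≠ 0 := (Real.sqrt_pos.mpr hN').ne'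
      rw [one_div, Real.sqrt_inv]
      nth_rewrite 1 [← hs]
      field_simp
    rwa [e] at this
  have lim : Filter.Tendsto (fun N : ℕ => ∫ x, f x ∂ν - B * (√N)⁻¹) Filter.atTop
      (nhds (∫ x, f x ∂ν - B * 0)) := by
    refine Filter.Tendsto.const_sub _ (Filter.Tendsto.const_mul _ ?_)
    exact (Real.tendsto_sqrt_atTop.comp tendsto_natCast_atTop_atTop).inv_tendsto_atTop
  rw [mul_zero, sub_zero] at lim
  exact le_of_tendsto lim (Filter.eventually_atTop.mpr ⟨1, fun N hN => main N hN⟩)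

end Lindeberg

/-! ### Gordon's comparison inequality -/

section Gordon

/-- A smooth decreasing cutoff from `1` on `(-∞, 1]` to `0` on `[2, ∞)`. -/
noncomputable def cutoff (x : ℝ) : ℝ := 1 - Real.smoothTransition (x - 1)

theorem cutoff_of_le {x : ℝ} (h : x ≤ 1) : cutoff x = 1 := by
  simp [cutoff, Real.smoothTransition.zero_of_nonpos (show x - 1 ≤ 0 by linarith)]

theorem cutoff_of_ge {x : ℝ} (h : 2 ≤ x) : cutoff x = 0 := by
  simp [cutoff, Real.smoothTransition.one_of_one_le (show 1 ≤ x - 1 by linarith)]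

theorem cutoff_nonneg (x : ℝ) : 0 ≤ cutoff x :=
  sub_nonneg.mpr (Real.smoothTransition.le_one _)

theorem cutoff_le_one (x : ℝ) : cutoff x ≤ 1 :=
  sub_le_self _ (Real.smoothTransition.nonneg _)

theorem contDiff_cutoff : ContDiff ℝ 3 cutoff :=
  contDiff_const.sub (Real.smoothTransition.contDiff.comp (contDiff_id.sub contDiff_const))

theorem deriv_cutoff_nonpos (x : ℝ) : deriv cutoff x ≤ 0 := by
  refine Antitone.deriv_nonpos fun a b hab => ?_
  exact sub_le_sub_left (Real.smoothTransition.monotone (sub_le_sub_right hab 1)) 1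

theorem exists_bound_iteratedDeriv_cutoff {n : ℕ} (hn : n ≤ 3) :
    ∃ M, ∀ x, |iteratedDeriv n cutoff x| ≤ M := by
  have hc : Continuous (iteratedDeriv n cutoff) :=
    contDiff_cutoff.continuous_iteratedDeriv n (by exact_mod_cast hn)
  obtain ⟨M, hM⟩ := isCompact_Icc.exists_bound_of_continuousOn (s := Set.Icc (1 : ℝ) 2)
    hc.continuousOn
  refine ⟨max M 1, fun x => ?_⟩
  have hconst : ∀ c : ℝ, |c| ≤ 1 → cutoff =ᶠ[nhds x] (fun _ => c) →
      |iteratedDeriv n cutoff x| ≤ max M 1 := by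
    intro c hc1 h
    rw [(h.iteratedDeriv n).eq_of_nhds, iteratedDeriv_const]
    split_ifs
    · exact hc1.trans (le_max_right _ _)
    · simp
  rcases lt_or_ge x 1 with h1 | h1
  · refine hconst 1 (by simp) ?_
    filter_upwards [Iio_mem_nhds h1] with y hy using cutoff_of_le (le_of_lt hy)
  rcases lt_or_ge 2 x with h2 | h2
  · refine hconst 0 (by simp) ?_
    filter_upwards [Ioi_mem_nhds h2] with y hy using cutoff_of_ge (le_of_lt hy)
  · exact (hM x ⟨h1, h2⟩).trans (le_max_left _ _)

theorem exists_bound_cutoff : ∃ M, ∀ x, |cutoff x| ≤ M ∧ |deriv cutoff x| ≤ M ∧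
    |iteratedDeriv 2 cutoff x| ≤ M ∧ |iteratedDeriv 3 cutoff x| ≤ M := by
  obtain ⟨M₁, h₁⟩ := exists_bound_iteratedDeriv_cutoff (n := 1) (by norm_num)
  obtain ⟨M₂, h₂⟩ := exists_bound_iteratedDeriv_cutoff (n := 2) (by norm_num)
  obtain ⟨M₃, h₃⟩ := exists_bound_iteratedDeriv_cutoff (n := 3) (by norm_num)
  refine ⟨max (max 1 M₁) (max M₂ M₃), fun x => ⟨?_, ?_, ?_, ?_⟩⟩
  · rw [abs_of_nonneg (cutoff_nonneg x)]
    exact (cutoff_le_one x).trans ((le_max_left _ _).trans (le_max_left _ _))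
  · rw [← iteratedDeriv_one]
    exact (h₁ x).trans ((le_max_right _ _).trans (le_max_left _ _))
  · exact (h₂ x).trans ((le_max_left _ _).trans (le_max_right _ _))
  · exact (h₃ x).trans ((le_max_right _ _).trans (le_max_right _ _))

variable {ι κ : Type*} [Fintype ι] [Fintype κ]

/-- The product of cutoffs over one block of coordinates is decreasing, and its derivatives only
involve that block. -/
theorem exists_hasTaylor_prod_cutoff (i : ι) (s : Finset κ) :
    ∃ D H, HasTaylor (fun x : ι × κ → ℝ => ∏ j ∈ s, cutoff (x (i, j))) D H ∧
      ∀ x, (∀ k, D x k ≤ 0) ∧ (∀ k, k.1 ≠ i → D x k = 0) ∧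
        ∀ k l, k.1 ≠ l.1 → H x k l = 0 := by
  classical
  obtain ⟨M, hM⟩ := exists_bound_cutoff
  induction s using Finset.induction_on with
  | empty =>
    refine ⟨_, _, hasTaylor_const 1, fun x => ⟨fun _ => le_rfl, fun _ _ => rfl,
      fun _ _ _ => rfl⟩⟩
  | insert j s hj ih =>
    obtain ⟨D, H, hf, hs⟩ := ih
    have hj' := (hasTaylor_coord contDiff_cutoff hM (i, j)).mul hf
    simp only [Finset.prod_insert hj]
    refine ⟨_, _, hj', fun x => ?_⟩
    obtain ⟨h1, h2, h3⟩ := hs x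
    have hp : 0 ≤ ∏ j ∈ s, cutoff (x (i, j)) := Finset.prod_nonneg fun _ _ => cutoff_nonneg _
    refine ⟨fun k => ?_, fun k hk => ?_, fun k l hkl => ?_⟩
    · refine add_nonpos (mul_nonpos_of_nonneg_of_nonpos (cutoff_nonneg _) (h1 k))
        (mul_nonpos_of_nonneg_of_nonpos hp ?_)
      split_ifs
      · exact deriv_cutoff_nonpos _
      · exact le_rfl
    · rw [h2 k hk, if_neg (fun h => hk (by rw [h]))]
      simp
    · rw [h3 k l hkl, if_neg (by rintro ⟨rfl, rfl⟩; exact hkl rfl)]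
      by_cases hk : k.1 = i
      · have hl : l.1 ≠ i := fun h => hkl (hk.trans h.symm)
        rw [h2 l hl, if_neg (fun h : l = (i, j) => hl (by rw [h]))]
        simp
      · rw [h2 k hk, if_neg (fun h : k = (i, j) => hk (by rw [h]))]
        simp

/-- The smooth surrogate of the indicator of `{x | ∀ i, ∃ j, x (i, j) is large}` is increasing, and
its second derivatives across two different blocks are nonnegative. -/
theorem exists_hasTaylor_prod_one_sub (s : Finset ι) :
    ∃ D H, HasTaylor (fun x : ι × κ → ℝ => ∏ i ∈ s, (1 - ∏ j, cutoff (x (i, j)))) D H ∧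
      ∀ x, (∀ k, 0 ≤ D x k) ∧ ∀ k l, k.1 ≠ l.1 → 0 ≤ H x k l := by
  classical
  induction s using Finset.induction_on with
  | empty =>
    refine ⟨_, _, hasTaylor_const 1, fun x => ⟨fun _ => le_rfl,
      fun _ _ _ => le_rfl⟩⟩
  | insert i s hi ih =>
    obtain ⟨D, H, hf, hs⟩ := ih
    obtain ⟨D', H', hf', hs'⟩ := exists_hasTaylor_prod_cutoff (ι := ι) i (Finset.univ : Finset κ)
    have hm := (hf'.const_sub 1).mul hf
    simp only [Finset.prod_insert hi]
    refine ⟨_, _, hm, fun x => ?_⟩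
    have hφ : ∀ i, 0 ≤ 1 - ∏ j, cutoff (x (i, j)) := fun i => sub_nonneg.mpr
      (Finset.prod_le_one (fun _ _ => cutoff_nonneg _) fun _ _ => cutoff_le_one _)
    have hp : 0 ≤ ∏ i ∈ s, (1 - ∏ j, cutoff (x (i, j))) := Finset.prod_nonneg fun i _ => hφ i
    obtain ⟨h1, h3⟩ := hs x
    obtain ⟨h1', -, h3'⟩ := hs' x
    refine ⟨fun k => ?_, fun k l hkl => ?_⟩
    · exact add_nonneg (mul_nonneg (hφ i) (h1 k)) (mul_nonneg hp (neg_nonneg.mpr (h1' k)))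
    · rw [h3' k l hkl, neg_zero, mul_zero, add_zero]
      exact add_nonneg (mul_nonneg (hφ i) (h3 k l hkl))
        (add_nonneg (mul_nonneg (neg_nonneg.mpr (h1' k)) (h1 l))
          (mul_nonneg (h1 k) (neg_nonneg.mpr (h1' l))))

theorem measurableSet_exists_forall_le (c : ℝ) :
    MeasurableSet {x : ι × κ → ℝ | ∃ i, ∀ j, x (i, j) ≤ c} := by
  have : {x : ι × κ → ℝ | ∃ i, ∀ j, x (i, j) ≤ c}
      = ⋃ i, ⋂ j, {x : ι × κ → ℝ | x (i, j) ≤ c} := by ext; simp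
  rw [this]
  exact MeasurableSet.iUnion fun i => MeasurableSet.iInter fun j =>
    measurableSet_le (measurable_pi_apply _) measurable_const

/-- **Gordon's inequality**, with a gap between the two thresholds that leaves room for smoothing:
if `μ` and `ν` have the same covariances inside each block of coordinates, and `μ` has the larger
covariances across blocks, then it is less likely under `μ` that the minimum over blocks of the
maxima in the block is small. -/
theorem gordon_comparison {μ ν : Measure (ι × κ → ℝ)} [IsGaussian μ] [IsGaussian ν]
    (hμ : μ[id] = 0) (hν : ν[id] = 0)
    (heq : ∀ k l : ι × κ, k.1 = l.1 → ∫ v, v k * v l ∂ν = ∫ v, v k * v l ∂μ)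
    (hle : ∀ k l : ι × κ, ∫ v, v k * v l ∂ν ≤ ∫ v, v k * v l ∂μ) :
    μ.real {x | ∃ i, ∀ j, x (i, j) ≤ 1} ≤ ν.real {x | ∃ i, ∀ j, x (i, j) ≤ 2} := by
  obtain ⟨D, H, hf, hs⟩ := exists_hasTaylor_prod_one_sub (κ := κ) (Finset.univ : Finset ι)
  set f : (ι × κ → ℝ) → ℝ := fun x => ∏ i, (1 - ∏ j, cutoff (x (i, j))) with hfdef
  have hmain : ∫ x, f x ∂ν ≤ ∫ x, f x ∂μ := by
    refine hf.integral_le_integral hμ hν fun x => Finset.sum_le_sum fun k _ =>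
      Finset.sum_le_sum fun l _ => ?_
    by_cases hkl : k.1 = l.1
    · rw [heq k l hkl]
    · exact mul_le_mul_of_nonneg_left (hle k l) ((hs x).2 k l hkl)
  have hφ : ∀ (x : ι × κ → ℝ) i, 0 ≤ 1 - ∏ j, cutoff (x (i, j)) := fun x i => sub_nonneg.mpr
      (Finset.prod_le_one (fun _ _ => cutoff_nonneg _) fun _ _ => cutoff_le_one _)
  have hφ1 : ∀ (x : ι × κ → ℝ) i, 1 - ∏ j, cutoff (x (i, j)) ≤ 1 := fun x i =>
    sub_le_self _ (Finset.prod_nonneg fun _ _ => cutoff_nonneg _)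
  have hf0 : ∀ x, 0 ≤ f x := fun x => Finset.prod_nonneg fun i _ => hφ x i
  have hf1 : ∀ x, f x ≤ 1 := fun x => Finset.prod_le_one (fun i _ => hφ x i) fun i _ => hφ1 x i
  have hI : ∀ (ρ : Measure (ι × κ → ℝ)) [IsFiniteMeasure ρ], Integrable f ρ := fun ρ _ =>
    (integrable_const (1 : ℝ)).mono' (hf.continuous.aestronglyMeasurable)
      (ae_of_all _ fun x => by rw [Real.norm_of_nonneg (hf0 x)]; exact hf1 x)
  have hlow : μ.real {x | ∃ i, ∀ j, x (i, j) ≤ 1} ≤ ∫ x, (1 - f x) ∂μ := by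
    rw [← integral_indicator_one (measurableSet_exists_forall_le 1)]
    refine integral_mono ((integrable_const (1 : ℝ)).indicator (measurableSet_exists_forall_le 1))
      ((integrable_const _).sub (hI μ)) fun x => ?_
    by_cases hx : x ∈ {x : ι × κ → ℝ | ∃ i, ∀ j, x (i, j) ≤ 1}
    · obtain ⟨i, hi⟩ := hx
      have : f x = 0 := Finset.prod_eq_zero (Finset.mem_univ i) (by
        rw [Finset.prod_eq_one fun j _ => cutoff_of_le (hi j), sub_self])
      rw [Set.indicator_of_mem (show x ∈ {x : ι × κ → ℝ | ∃ i, ∀ j, x (i, j) ≤ 1} from ⟨i, hi⟩)]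
      simp [this]
    · rw [Set.indicator_of_notMem hx]
      exact sub_nonneg.mpr (hf1 x)
  have hhigh : ∫ x, (1 - f x) ∂ν ≤ ν.real {x | ∃ i, ∀ j, x (i, j) ≤ 2} := by
    rw [← integral_indicator_one (measurableSet_exists_forall_le 2)]
    refine integral_mono ((integrable_const _).sub (hI ν))
      ((integrable_const (1 : ℝ)).indicator (measurableSet_exists_forall_le 2)) fun x => ?_
    by_cases hx : x ∈ {x : ι × κ → ℝ | ∃ i, ∀ j, x (i, j) ≤ 2}
    · rw [Set.indicator_of_mem hx]
      exact sub_le_self _ (hf0 x)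
    · rw [Set.indicator_of_notMem hx]
      simp only [Set.mem_ofPred_eq, not_exists, not_forall, not_le] at hx
      have : f x = 1 := Finset.prod_eq_one fun i _ => by
        obtain ⟨j, hj⟩ := hx i
        rw [Finset.prod_eq_zero (Finset.mem_univ j) (cutoff_of_ge hj.le), sub_zero]
      simp [this]
  rw [integral_sub (integrable_const _) (hI μ)] at hlow
  rw [integral_sub (integrable_const _) (hI ν)] at hhigh
  simp only [integral_const, probReal_univ, smul_eq_mul, mul_one] at hlow hhigh
  linarith

end Gordon

/-! ### Gaussian processes indexed by finite families of vectors -/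

section Pairing

open scoped RealInnerProductSpace

variable {E F : Type*} [NormedAddCommGroup E] [InnerProductSpace ℝ E]
  [NormedAddCommGroup F] [InnerProductSpace ℝ F] {κ : Type*}

/-- The linear map sending a pair of vectors to the values at them of the linear functionals
represented by `(a k, b k)`. -/
noncomputable def pairing (a : κ → E) (b : κ → F) : E × F →L[ℝ] (κ → ℝ) :=
  ContinuousLinearMap.pi fun k =>
    (innerSL ℝ (a k)).comp (ContinuousLinearMap.fst ℝ E F)
      + (innerSL ℝ (b k)).comp (ContinuousLinearMap.snd ℝ E F)

@[simp]
theorem pairing_apply (a : κ → E) (b : κ → F) (z : E × F) (k : κ) :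
    pairing a b z k = ⟪a k, z.1⟫ + ⟪b k, z.2⟫ := rfl

variable [FiniteDimensional ℝ E] [MeasurableSpace E] [BorelSpace E] [FiniteDimensional ℝ F]
  [MeasurableSpace F] [BorelSpace F] [Fintype κ]

theorem integral_inner_mul_inner_stdGaussian (a b : E) :
    ∫ z, ⟪a, z⟫ * ⟪b, z⟫ ∂(stdGaussian E) = ⟪a, b⟫ := by
  have h := covarianceBilin_apply (μ := stdGaussian E) IsGaussian.memLp_two_id a b
  have h0 : (stdGaussian E)[id] = 0 := integral_id_stdGaussian
  rw [covarianceBilin_stdGaussian, h0] at h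
  simp only [sub_zero] at h
  exact h.symm

theorem integral_inner_stdGaussian (a : E) : ∫ z, ⟪a, z⟫ ∂(stdGaussian E) = 0 :=
  integral_strongDual_stdGaussian (innerSL ℝ a)

theorem integral_id_map_pairing (a : κ → E) (b : κ → F) :
    (((stdGaussian E).prod (stdGaussian F)).map (pairing a b))[id] = 0 := by
  have h1 : ∫ z, z ∂((stdGaussian E).prod (stdGaussian F)) = 0 := by
    have hI : Integrable (fun z : E × F => z) ((stdGaussian E).prod (stdGaussian F)) :=
      IsGaussian.integrable_id
    have e1 : (∫ z, z ∂((stdGaussian E).prod (stdGaussian F))).1 = 0 := by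
      rw [fst_integral hI, integral_fun_fst (f := fun z : E => z)]; simp
    have e2 : (∫ z, z ∂((stdGaussian E).prod (stdGaussian F))).2 = 0 := by
      rw [snd_integral hI, integral_fun_snd (f := fun z : F => z)]; simp
    exact Prod.ext e1 e2
  simp only [id_eq]
  rw [ContinuousLinearMap.integral_id_map IsGaussian.integrable_id, h1, map_zero]

theorem integral_mul_map_pairing (a : κ → E) (b : κ → F) (k l : κ) :
    ∫ v, v k * v l ∂(((stdGaussian E).prod (stdGaussian F)).map (pairing a b))
      = ⟪a k, a l⟫ + ⟪b k, b l⟫ := by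
  rw [integral_map (by fun_prop) (by fun_prop)]
  simp only [pairing_apply]
  have hE : ∀ c : E, MemLp (fun z : E => ⟪c, z⟫) 2 (stdGaussian E) := fun c =>
    IsGaussian.memLp_dual (stdGaussian E) (innerSL ℝ c) 2 (by simp)
  have hF : ∀ c : F, MemLp (fun z : F => ⟪c, z⟫) 2 (stdGaussian F) := fun c =>
    IsGaussian.memLp_dual (stdGaussian F) (innerSL ℝ c) 2 (by simp)
  have h1 : ∀ c : E, MemLp (fun z : E × F => ⟪c, z.1⟫) 2
      ((stdGaussian E).prod (stdGaussian F)) := fun c => (hE c).comp_fst _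
  have h2 : ∀ c : F, MemLp (fun z : E × F => ⟪c, z.2⟫) 2
      ((stdGaussian E).prod (stdGaussian F)) := fun c => (hF c).comp_snd _
  have e : ∀ z : E × F, (⟪a k, z.1⟫ + ⟪b k, z.2⟫) * (⟪a l, z.1⟫ + ⟪b l, z.2⟫)
      = ⟪a k, z.1⟫ * ⟪a l, z.1⟫ + ⟪a k, z.1⟫ * ⟪b l, z.2⟫
        + (⟪a l, z.1⟫ * ⟪b k, z.2⟫ + ⟪b k, z.2⟫ * ⟪b l, z.2⟫) := fun z => by ring
  simp only [e]
  have i1 : Integrable (fun z : E × F => ⟪a k, z.1⟫ * ⟪a l, z.1⟫)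
      ((stdGaussian E).prod (stdGaussian F)) := (h1 (a k)).integrable_mul (h1 (a l))
  have i2 : Integrable (fun z : E × F => ⟪a k, z.1⟫ * ⟪b l, z.2⟫)
      ((stdGaussian E).prod (stdGaussian F)) := (h1 (a k)).integrable_mul (h2 (b l))
  have i3 : Integrable (fun z : E × F => ⟪a l, z.1⟫ * ⟪b k, z.2⟫)
      ((stdGaussian E).prod (stdGaussian F)) := (h1 (a l)).integrable_mul (h2 (b k))
  have i4 : Integrable (fun z : E × F => ⟪b k, z.2⟫ * ⟪b l, z.2⟫)
      ((stdGaussian E).prod (stdGaussian F)) := (h2 (b k)).integrable_mul (h2 (b l))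
  have i12 : Integrable (fun z : E × F => ⟪a k, z.1⟫ * ⟪a l, z.1⟫ + ⟪a k, z.1⟫ * ⟪b l, z.2⟫)
      ((stdGaussian E).prod (stdGaussian F)) := i1.add i2
  have i34 : Integrable (fun z : E × F => ⟪a l, z.1⟫ * ⟪b k, z.2⟫ + ⟪b k, z.2⟫ * ⟪b l, z.2⟫)
      ((stdGaussian E).prod (stdGaussian F)) := i3.add i4
  rw [integral_add i12 i34, integral_add i1 i2, integral_add i3 i4,
    integral_fun_fst (f := fun z : E => ⟪a k, z⟫ * ⟪a l, z⟫),
    integral_fun_snd (f := fun z : F => ⟪b k, z⟫ * ⟪b l, z⟫),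
    integral_prod_mul (fun z : E => ⟪a k, z⟫) (fun z : F => ⟪b l, z⟫),
    integral_prod_mul (fun z : E => ⟪a l, z⟫) (fun z : F => ⟪b k, z⟫),
    integral_inner_mul_inner_stdGaussian, integral_inner_mul_inner_stdGaussian,
    integral_inner_stdGaussian (a k), integral_inner_stdGaussian (a l)]
  simp

end Pairing

/-! ### Gaussian concentration of sublinear functions -/

section Concentration

open scoped RealInnerProductSpace

variable {E : Type*} [NormedAddCommGroup E] [InnerProductSpace ℝ E]

/-- `F` is the support function of a subset of the unit ball, with the supremum attained: at each
point `z` some `p` in the ball attains `F z`, and its linear functional minorizes `F`. -/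
def IsUnitSupport (F : E → ℝ) : Prop :=
  ∀ z, ∃ p, ‖p‖ ≤ 1 ∧ F z = ⟪z, p⟫ ∧ ∀ x, ⟪x, p⟫ ≤ F x

theorem IsUnitSupport.sub_le {F : E → ℝ} (hF : IsUnitSupport F) (z x : E) :
    F z - F x ≤ ‖z - x‖ := by
  obtain ⟨p, hp, hz, hx⟩ := hF z
  calc F z - F x ≤ ⟪z, p⟫ - ⟪x, p⟫ := by rw [hz]; linarith [hx x]
    _ = ⟪z - x, p⟫ := by rw [inner_sub_left]
    _ ≤ ‖z - x‖ * ‖p‖ := real_inner_le_norm _ _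
    _ ≤ ‖z - x‖ := mul_le_of_le_one_right (norm_nonneg _) hp

theorem IsUnitSupport.abs_le_norm {F : E → ℝ} (hF : IsUnitSupport F) (z : E) : |F z| ≤ ‖z‖ := by
  have h0 : F 0 = 0 := by
    obtain ⟨p, -, h, -⟩ := hF 0
    simpa using h
  have h1 := hF.sub_le z 0
  have h2 := hF.sub_le 0 z
  rw [h0] at h1 h2
  rw [abs_le]
  simp only [sub_zero, zero_sub, norm_neg] at h1 h2
  constructor <;> linarith

theorem IsUnitSupport.continuous {F : E → ℝ} (hF : IsUnitSupport F) : Continuous F := by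
  refine LipschitzWith.continuous (K := 1) (LipschitzWith.of_dist_le_mul fun x y => ?_)
  rw [Real.dist_eq, abs_le, dist_eq_norm, NNReal.coe_one, one_mul]
  have h1 := hF.sub_le x y
  have h2 := hF.sub_le y x
  rw [norm_sub_rev] at h2
  constructor <;> linarith

variable [FiniteDimensional ℝ E] [MeasurableSpace E] [BorelSpace E]

theorem integrable_exp_mul_norm (c : ℝ) :
    Integrable (fun z : E => Real.exp (c * ‖z‖)) (stdGaussian E) := by
  obtain ⟨C, hC, h⟩ := IsGaussian.exists_integrable_exp_sq (stdGaussian E)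
  refine (h.const_mul (Real.exp (c ^ 2 / (4 * C)))).mono' (by fun_prop) (ae_of_all _ fun z => ?_)
  rw [Real.norm_of_nonneg (Real.exp_nonneg _), ← Real.exp_add, Real.exp_le_exp]
  have : c ^ 2 / (4 * C) + C * ‖z‖ ^ 2 - c * ‖z‖ = (c - 2 * C * ‖z‖) ^ 2 / (4 * C) := by
    field_simp; ring
  have h2 : 0 ≤ (c - 2 * C * ‖z‖) ^ 2 / (4 * C) := by positivity
  linarith

theorem integral_exp_inner (p : E) (c : ℝ) :
    ∫ z, Real.exp (c * ⟪z, p⟫) ∂(stdGaussian E) = Real.exp (c ^ 2 * ‖p‖ ^ 2 / 2) := by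
  have h := mgf_gaussianReal (IsGaussian.map_eq_gaussianReal (μ := stdGaussian E) (innerSL ℝ p)) c
  rw [integral_strongDual_stdGaussian, variance_dual_stdGaussian, innerSL_apply_norm,
    Real.coe_toNNReal _ (by positivity)] at h
  simp only [mgf, innerSL_apply_apply, zero_mul, zero_add] at h
  simp only [real_inner_comm p]
  rw [h]
  ring_nf

variable {F : E → ℝ}

theorem integrable_exp_of_abs_le {G : E × E → ℝ} (hG : Continuous G) {c : ℝ}
    (h : ∀ z, G z ≤ c * (‖z.1‖ + ‖z.2‖)) :
    Integrable (fun z => Real.exp (G z)) ((stdGaussian E).prod (stdGaussian E)) := by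
  refine ((integrable_exp_mul_norm c).mul_prod (integrable_exp_mul_norm c)).mono'
    (by fun_prop) (ae_of_all _ fun z => ?_)
  rw [Real.norm_of_nonneg (Real.exp_nonneg _), ← Real.exp_add, Real.exp_le_exp, ← mul_add]
  exact h z

theorem IsUnitSupport.integrable_exp_sub (hF : IsUnitSupport F) {c : ℝ} (hc : 0 ≤ c)
    (a b a' b' : ℝ) : Integrable (fun z : E × E => Real.exp (c * (F (a • z.1 + b • z.2)
      - F (a' • z.1 + b' • z.2)))) ((stdGaussian E).prod (stdGaussian E)) := by
  have hFc := hF.continuous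
  refine integrable_exp_of_abs_le (c := c * (|a| + |b| + |a'| + |b'|)) (by fun_prop) fun z => ?_
  rw [mul_assoc]
  refine mul_le_mul_of_nonneg_left ?_ hc
  have key : ∀ a b : ℝ, |F (a • z.1 + b • z.2)| ≤ |a| * ‖z.1‖ + |b| * ‖z.2‖ := fun a b =>
    (hF.abs_le_norm _).trans ((norm_add_le _ _).trans (by simp [norm_smul]))
  have h1 := (abs_le.mp (key a b)).2
  have h2 := (abs_le.mp (key a' b')).1
  nlinarith [norm_nonneg z.1, norm_nonneg z.2, abs_nonneg a, abs_nonneg b, abs_nonneg a',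
    abs_nonneg b']

/-- A single rotation step. By convexity the increment of `F` is at most its linearization at the
end point `z.1`, and the direction `z.2` of the linear part is independent of `z.1`. -/
theorem IsUnitSupport.integral_exp_step_le (hF : IsUnitSupport F) {c : ℝ} (hc : 0 ≤ c) (δ : ℝ) :
    ∫ z : E × E, Real.exp (c * (F z.1 - F (Real.cos δ • z.1 - Real.sin δ • z.2)))
        ∂((stdGaussian E).prod (stdGaussian E))
      ≤ Real.exp ((c * Real.sin δ) ^ 2 / 2)
        * ∫ z, Real.exp (c * (1 - Real.cos δ) * ‖z‖) ∂(stdGaussian E) := by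
  have hI := hF.integrable_exp_sub hc 1 0 (Real.cos δ) (-Real.sin δ)
  simp only [one_smul, zero_smul, add_zero, neg_smul, ← sub_eq_add_neg] at hI
  rw [integral_prod _ hI, ← integral_const_mul]
  refine integral_mono_ae hI.integral_prod_left ((integrable_exp_mul_norm _).const_mul _) ?_
  filter_upwards [hI.prod_right_ae] with x hx
  obtain ⟨p, hp, hxp, hmin⟩ := hF x
  have hpt : ∀ w, c * (F x - F (Real.cos δ • x - Real.sin δ • w))
      ≤ c * (1 - Real.cos δ) * ‖x‖ + c * Real.sin δ * ⟪w, p⟫ := by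
    intro w
    have h1 := hmin (Real.cos δ • x - Real.sin δ • w)
    rw [inner_sub_left, real_inner_smul_left, real_inner_smul_left, ← hxp] at h1
    have h2 := (abs_le.mp (hF.abs_le_norm x)).2
    have h3 : (1 - Real.cos δ) * F x ≤ (1 - Real.cos δ) * ‖x‖ :=
      mul_le_mul_of_nonneg_left h2 (sub_nonneg.mpr (Real.cos_le_one δ))
    calc c * (F x - F (Real.cos δ • x - Real.sin δ • w))
        ≤ c * ((1 - Real.cos δ) * ‖x‖ + Real.sin δ * ⟪w, p⟫) :=
          mul_le_mul_of_nonneg_left (by linarith) hc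
      _ = _ := by ring
  have hIp : Integrable (fun w : E => Real.exp (c * (1 - Real.cos δ) * ‖x‖)
      * Real.exp (c * Real.sin δ * ⟪w, p⟫)) (stdGaussian E) := by
    refine Integrable.const_mul ?_ _
    refine (integrable_exp_mul_norm |c * Real.sin δ|).mono' (by fun_prop)
      (ae_of_all _ fun w => ?_)
    rw [Real.norm_of_nonneg (Real.exp_nonneg _), Real.exp_le_exp]
    refine (le_abs_self _).trans ?_
    rw [abs_mul]
    refine mul_le_mul_of_nonneg_left ?_ (abs_nonneg _)
    exact (abs_real_inner_le_norm _ _).trans (mul_le_of_le_one_right (norm_nonneg _) hp)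
  calc ∫ w, Real.exp (c * (F x - F (Real.cos δ • x - Real.sin δ • w))) ∂(stdGaussian E)
      ≤ ∫ w, Real.exp (c * (1 - Real.cos δ) * ‖x‖) * Real.exp (c * Real.sin δ * ⟪w, p⟫)
          ∂(stdGaussian E) := by
        refine integral_mono hx hIp fun w => ?_
        rw [← Real.exp_add]
        exact Real.exp_le_exp.mpr (hpt w)
    _ = Real.exp (c * (1 - Real.cos δ) * ‖x‖) * Real.exp ((c * Real.sin δ) ^ 2 * ‖p‖ ^ 2 / 2) := by
        rw [integral_const_mul, integral_exp_inner]
    _ ≤ _ := by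
        rw [mul_comm]
        refine mul_le_mul_of_nonneg_right (Real.exp_le_exp.mpr ?_) (Real.exp_nonneg _)
        have : ‖p‖ ^ 2 ≤ 1 := pow_le_one₀ (norm_nonneg _) hp
        have h4 := mul_le_of_le_one_right (sq_nonneg (c * Real.sin δ)) this
        linarith

/-- The quarter turn from `x` to `y` is cut into `N + 1` rotations, whose increments are compared by
Jensen's inequality. -/
theorem IsUnitSupport.integral_exp_sub_le_aux (hF : IsUnitSupport F) {c : ℝ} (hc : 0 ≤ c) (N : ℕ) :
    ∫ z : E × E, Real.exp (c * (F z.2 - F z.1)) ∂((stdGaussian E).prod (stdGaussian E))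
      ≤ Real.exp (Real.pi ^ 2 / 8 * c ^ 2)
        * ∫ z, Real.exp (c * Real.pi ^ 2 / 8 / (N + 1) * ‖z‖) ∂(stdGaussian E) := by
  have hN : (0 : ℝ) < (N : ℝ) + 1 := by positivity
  have hFc := hF.continuous
  set Γ := (stdGaussian E).prod (stdGaussian E) with hΓ
  set δ := Real.pi / 2 / (N + 1) with hδ
  have hδ0 : 0 ≤ δ := by positivity
  have hNδ : ((N : ℝ) + 1) * δ = Real.pi / 2 := by rw [hδ]; field_simp
  let U : ℕ → E × E → E := fun k z => Real.cos (k * δ) • z.1 + Real.sin (k * δ) • z.2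
  have hrot : ∀ θ : ℝ, Γ.map (ContinuousLinearMap.rotation θ) = Γ := fun θ =>
    IsGaussian.map_rotation_eq_self (by simp) θ
  have hchange : ∀ (θ : ℝ) (g : E × E → ℝ), Continuous g →
      ∫ z, g (ContinuousLinearMap.rotation θ z) ∂Γ = ∫ z, g z ∂Γ := by
    intro θ g hg
    conv_rhs => rw [← hrot θ]
    rw [integral_map (by fun_prop) hg.aestronglyMeasurable]
  have htel : ∀ z : E × E, F z.2 - F z.1
      = ∑ k ∈ Finset.range (N + 1), (F (U (k + 1) z) - F (U k z)) := by
    intro z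
    rw [Finset.sum_range_sub (fun k => F (U k z))]
    have h1 : U 0 z = z.1 := by simp [U]
    have h2 : U (N + 1) z = z.2 := by
      simp only [U]
      push_cast
      rw [hNδ]; simp
    rw [h1, h2]
  have hjens : ∀ z : E × E, Real.exp (c * (F z.2 - F z.1))
      ≤ ∑ k ∈ Finset.range (N + 1), ((N : ℝ) + 1)⁻¹
          * Real.exp (c * (N + 1) * (F (U (k + 1) z) - F (U k z))) := by
    intro z
    have := convexOn_exp.map_sum_le (t := Finset.range (N + 1)) (w := fun _ => ((N : ℝ) + 1)⁻¹)
      (p := fun k => c * (N + 1) * (F (U (k + 1) z) - F (U k z))) (fun _ _ => by positivity)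
      (by simp; field_simp) (fun _ _ => Set.mem_univ _)
    simp only [smul_eq_mul] at this
    refine le_trans (le_of_eq ?_) this
    rw [htel, Finset.mul_sum]
    congr 1
    refine Finset.sum_congr rfl fun k _ => ?_
    field_simp
  have hstep : ∀ k : ℕ, ∫ z, Real.exp (c * (N + 1) * (F (U (k + 1) z) - F (U k z))) ∂Γ
      = ∫ z : E × E, Real.exp (c * (N + 1)
          * (F z.1 - F (Real.cos δ • z.1 - Real.sin δ • z.2))) ∂Γ := by
    intro k
    rw [← hchange (((k + 1 : ℕ) : ℝ) * δ) (fun z : E × E => Real.exp (c * (N + 1)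
          * (F z.1 - F (Real.cos δ • z.1 - Real.sin δ • z.2)))) (by fun_prop)]
    refine integral_congr_ae (ae_of_all _ fun z => ?_)
    simp only [ContinuousLinearMap.rotation_apply]
    have e : Real.cos δ • (Real.cos (((k + 1 : ℕ) : ℝ) * δ) • z.1
          + Real.sin (((k + 1 : ℕ) : ℝ) * δ) • z.2)
        - Real.sin δ • (-Real.sin (((k + 1 : ℕ) : ℝ) * δ) • z.1
          + Real.cos (((k + 1 : ℕ) : ℝ) * δ) • z.2) = U k z := by
      simp only [U]
      have hk : (k : ℝ) * δ = ((k + 1 : ℕ) : ℝ) * δ - δ := by push_cast; ring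
      rw [hk, Real.cos_sub, Real.sin_sub]
      module
    rw [e]
  have hI : ∀ k : ℕ, Integrable (fun z =>
      Real.exp (c * (N + 1) * (F (U (k + 1) z) - F (U k z)))) Γ := fun k =>
    hF.integrable_exp_sub (by positivity) _ _ _ _
  have hI0 : Integrable (fun z : E × E => Real.exp (c * (F z.2 - F z.1))) Γ := by
    simpa using hF.integrable_exp_sub hc 0 1 1 0
  have hbound := hF.integral_exp_step_le (E := E) (c := c * (N + 1)) (by positivity) δ
  calc ∫ z : E × E, Real.exp (c * (F z.2 - F z.1)) ∂Γ
      ≤ ∫ z, ∑ k ∈ Finset.range (N + 1), ((N : ℝ) + 1)⁻¹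
          * Real.exp (c * (N + 1) * (F (U (k + 1) z) - F (U k z))) ∂Γ :=
        integral_mono hI0 (integrable_finsetSum _ fun k _ => (hI k).const_mul _) hjens
    _ = ∫ z : E × E, Real.exp (c * (N + 1)
          * (F z.1 - F (Real.cos δ • z.1 - Real.sin δ • z.2))) ∂Γ := by
        rw [integral_finsetSum _ fun k _ => (hI k).const_mul _]
        simp only [integral_const_mul, hstep, Finset.sum_const, Finset.card_range, nsmul_eq_mul]
        push_cast
        field_simp
    _ ≤ _ := hbound
    _ ≤ _ := by
        have hsin0 : 0 ≤ Real.sin δ := Real.sin_nonneg_of_nonneg_of_le_pi hδ0 (by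
          have : δ ≤ (N + 1) * δ :=
            le_mul_of_one_le_left hδ0 (by linarith [Nat.cast_nonneg (α := ℝ) N])
          rw [hNδ] at this
          linarith [Real.pi_pos])
        have hsin : (N + 1) * Real.sin δ ≤ Real.pi / 2 := by
          rw [← hNδ]; exact mul_le_mul_of_nonneg_left (Real.sin_le hδ0) hN.le
        have hcos : (N + 1) * (1 - Real.cos δ) ≤ Real.pi ^ 2 / 8 / (N + 1) := by
          have h1 := Real.one_sub_sq_div_two_le_cos (x := δ)
          have h2 : (N + 1) * (δ ^ 2 / 2) = Real.pi ^ 2 / 8 / (N + 1) := by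
            rw [hδ]; field_simp; ring
          rw [← h2]
          exact mul_le_mul_of_nonneg_left (by linarith) hN.le
        refine mul_le_mul (Real.exp_le_exp.mpr ?_) ?_ (integral_nonneg fun _ => Real.exp_nonneg _)
          (Real.exp_nonneg _)
        · have : (c * ((N + 1) * Real.sin δ)) ^ 2 ≤ (c * (Real.pi / 2)) ^ 2 := by gcongr
          calc (c * (N + 1) * Real.sin δ) ^ 2 / 2 = (c * ((N + 1) * Real.sin δ)) ^ 2 / 2 := by ring
            _ ≤ (c * (Real.pi / 2)) ^ 2 / 2 := by linarith
            _ = _ := by ring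
        · refine integral_mono (integrable_exp_mul_norm _) (integrable_exp_mul_norm _) fun z => ?_
          refine Real.exp_le_exp.mpr (mul_le_mul_of_nonneg_right ?_ (norm_nonneg _))
          calc c * (N + 1) * (1 - Real.cos δ) = c * ((N + 1) * (1 - Real.cos δ)) := by ring
            _ ≤ c * (Real.pi ^ 2 / 8 / (N + 1)) := mul_le_mul_of_nonneg_left hcos hc
            _ = _ := by ring

/-- The Maurey–Pisier bound, for all real `c`. -/
theorem IsUnitSupport.integral_exp_sub_le (hF : IsUnitSupport F) (c : ℝ) :
    ∫ z : E × E, Real.exp (c * (F z.2 - F z.1)) ∂((stdGaussian E).prod (stdGaussian E))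
      ≤ Real.exp (Real.pi ^ 2 / 8 * c ^ 2) := by
  wlog hc : 0 ≤ c generalizing c
  · have h := this (-c) (by linarith)
    rw [← integral_prod_swap, neg_sq] at h
    refine le_trans (le_of_eq (integral_congr_ae (ae_of_all _ fun z => ?_))) h
    simp only [Prod.fst_swap, Prod.snd_swap]
    congr 1; ring
  have lim : Filter.Tendsto (fun N : ℕ => Real.exp (Real.pi ^ 2 / 8 * c ^ 2)
        * ∫ z, Real.exp (c * Real.pi ^ 2 / 8 / (N + 1) * ‖z‖) ∂(stdGaussian E)) Filter.atTop
      (nhds (Real.exp (Real.pi ^ 2 / 8 * c ^ 2) * ∫ _ : E, (1 : ℝ) ∂(stdGaussian E))) := by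
    refine Filter.Tendsto.const_mul _ ?_
    refine tendsto_integral_of_dominated_convergence
      (fun z => Real.exp (c * Real.pi ^ 2 / 8 * ‖z‖)) (fun N => by fun_prop)
      (integrable_exp_mul_norm _) (fun N => ae_of_all _ fun z => ?_) (ae_of_all _ fun z => ?_)
    · rw [Real.norm_of_nonneg (Real.exp_nonneg _), Real.exp_le_exp]
      refine mul_le_mul_of_nonneg_right (div_le_self (by positivity) ?_) (norm_nonneg _)
      linarith [Nat.cast_nonneg (α := ℝ) N]
    · rw [show (1 : ℝ) = Real.exp 0 from Real.exp_zero.symm]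
      refine (Real.continuous_exp.tendsto 0).comp ?_
      simp only [Real.exp_zero]
      have h := (tendsto_one_div_add_atTop_nhds_zero_nat (𝕜 := ℝ)).const_mul
        (c * Real.pi ^ 2 / 8 * ‖z‖)
      rw [mul_zero] at h
      refine h.congr fun N => ?_
      ring
  have := ge_of_tendsto' lim fun N => hF.integral_exp_sub_le_aux hc N
  simpa using this

theorem IsUnitSupport.integrable (hF : IsUnitSupport F) : Integrable F (stdGaussian E) := by
  have := hF.continuous
  refine (IsGaussian.integrable_id (μ := stdGaussian E)).norm.mono' (by fun_prop)
    (ae_of_all _ fun z => ?_)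
  exact hF.abs_le_norm z

theorem IsUnitSupport.integrable_exp_mul (hF : IsUnitSupport F) (c m : ℝ) :
    Integrable (fun x => Real.exp (c * (F x - m))) (stdGaussian E) := by
  have := hF.continuous
  refine ((integrable_exp_mul_norm |c|).const_mul (Real.exp (-(c * m)))).mono' (by fun_prop)
    (ae_of_all _ fun z => ?_)
  rw [Real.norm_of_nonneg (Real.exp_nonneg _), ← Real.exp_add, Real.exp_le_exp]
  have h1 : c * F z ≤ |c| * ‖z‖ := (le_abs_self _).trans (by
    rw [abs_mul]; exact mul_le_mul_of_nonneg_left (hF.abs_le_norm z) (abs_nonneg _))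
  linarith

/-- A sublinear `1`-Lipschitz function of a standard Gaussian vector is sub-Gaussian, with a
constant that does not depend on the dimension. -/
theorem IsUnitSupport.hasSubgaussianMGF (hF : IsUnitSupport F) :
    HasSubgaussianMGF (fun x => F x - ∫ y, F y ∂(stdGaussian E)) (5 / 2) (stdGaussian E) where
  integrable_exp_mul t := hF.integrable_exp_mul t _
  mgf_le t := by
    set m := ∫ y, F y ∂(stdGaussian E) with hm
    have hI : Integrable (fun z : E × E => Real.exp (-t * (F z.2 - F z.1)))
        ((stdGaussian E).prod (stdGaussian E)) := by
      rcases le_total 0 (-t) with h | h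
      · simpa using hF.integrable_exp_sub h 0 1 1 0
      · have := hF.integrable_exp_sub (c := t) (by linarith) 1 0 0 1
        simp only [one_smul, zero_smul, add_zero, zero_add] at this
        refine this.congr (ae_of_all _ fun z => ?_)
        simp only
        congr 1; ring
    have hpt : ∀ x, Integrable (fun y => Real.exp (-t * (F y - F x))) (stdGaussian E) :=
      fun x => hF.integrable_exp_mul (-t) (F x)
    have hjens : ∀ x, Real.exp (t * (F x - m))
        ≤ ∫ y, Real.exp (-t * (F y - F x)) ∂(stdGaussian E) := by
      intro x
      have hI1 : Integrable (fun y => -t * (F y - F x)) (stdGaussian E) :=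
        (hF.integrable.sub (integrable_const _)).const_mul _
      have h := convexOn_exp.map_integral_le (μ := stdGaussian E)
        (f := fun y => -t * (F y - F x)) Real.continuous_exp.continuousOn isClosed_univ
        (ae_of_all _ fun _ => Set.mem_univ _) hI1 (hpt x)
      have e : ∫ y, -t * (F y - F x) ∂(stdGaussian E) = t * (F x - m) := by
        rw [integral_const_mul, integral_sub hF.integrable (integrable_const _)]
        simp only [integral_const, probReal_univ, smul_eq_mul, one_mul, ← hm]
        ring
      rwa [e] at h
    have hpi : Real.pi ^ 2 ≤ 10 := by nlinarith [Real.pi_lt_d2, Real.pi_pos]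
    calc mgf (fun x => F x - m) (stdGaussian E) t
        = ∫ x, Real.exp (t * (F x - m)) ∂(stdGaussian E) := rfl
      _ ≤ ∫ x, ∫ y, Real.exp (-t * (F y - F x)) ∂(stdGaussian E) ∂(stdGaussian E) :=
          integral_mono (hF.integrable_exp_mul t m) hI.integral_prod_left hjens
      _ = ∫ z : E × E, Real.exp (-t * (F z.2 - F z.1)) ∂((stdGaussian E).prod (stdGaussian E)) :=
          (integral_prod _ hI).symm
      _ ≤ Real.exp (Real.pi ^ 2 / 8 * (-t) ^ 2) := hF.integral_exp_sub_le (-t)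
      _ ≤ Real.exp (((5 / 2 : NNReal) : ℝ) * t ^ 2 / 2) := by
          refine Real.exp_le_exp.mpr ?_
          push_cast
          nlinarith [sq_nonneg t]

theorem IsUnitSupport.memLp_two (hF : IsUnitSupport F) : MemLp F 2 (stdGaussian E) := by
  have := hF.continuous
  refine (IsGaussian.memLp_two_id (μ := stdGaussian E)).mono (by fun_prop) (ae_of_all _ fun z => ?_)
  exact hF.abs_le_norm z

theorem IsUnitSupport.integral_sq_le (hF : IsUnitSupport F) :
    ∫ x, F x ^ 2 ∂(stdGaussian E) ≤ (∫ x, F x ∂(stdGaussian E)) ^ 2 + 16 := by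
  set m := ∫ y, F y ∂(stdGaussian E) with hm
  have hs := hF.hasSubgaussianMGF
  have hpt : ∀ x, (F x - m) ^ 2 ≤ 2 * (Real.exp (1 * (F x - m)) + Real.exp (-1 * (F x - m))) := by
    intro x
    have h1 := Real.quadratic_le_exp_of_nonneg (abs_nonneg (F x - m))
    have h2 : Real.exp |F x - m| ≤ Real.exp (1 * (F x - m)) + Real.exp (-1 * (F x - m)) := by
      rcases abs_cases (F x - m) with ⟨h, -⟩ | ⟨h, -⟩ <;> rw [h]
      · rw [one_mul]; linarith [Real.exp_pos (-1 * (F x - m))]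
      · rw [neg_one_mul]; linarith [Real.exp_pos (1 * (F x - m))]
    rw [sq_abs] at h1
    linarith [abs_nonneg (F x - m)]
  have hsq := hF.memLp_two.integrable_sq
  have hsq' : Integrable (fun x => (F x - m) ^ 2) (stdGaussian E) :=
    (hF.memLp_two.sub (memLp_const m)).integrable_sq
  have hle : ∫ x, (F x - m) ^ 2 ∂(stdGaussian E) ≤ 16 := by
    have hmgf : ∀ t : ℝ, t ^ 2 = 1 →
        ∫ x, Real.exp (t * (F x - m)) ∂(stdGaussian E) ≤ 4 := by
      intro t ht
      refine (hs.mgf_le t).trans ?_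
      rw [ht]
      have e1 : ((5 / 2 : NNReal) : ℝ) * 1 / 2 = 1 + 1 / 4 := by push_cast; norm_num
      rw [e1, Real.exp_add]
      have e2 : Real.exp (1 / 4) ≤ 4 / 3 := by
        have h := Real.one_sub_le_exp_neg (1 / 4)
        rw [Real.exp_neg] at h
        have h' := inv_anti₀ (by norm_num) h
        rw [inv_inv] at h'
        linarith
      have e3 := Real.exp_one_lt_d9
      nlinarith [Real.exp_pos 1, Real.exp_pos (1 / 4)]
    calc ∫ x, (F x - m) ^ 2 ∂(stdGaussian E)
        ≤ ∫ x, 2 * (Real.exp (1 * (F x - m)) + Real.exp (-1 * (F x - m))) ∂(stdGaussian E) :=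
          integral_mono hsq' (((hF.integrable_exp_mul 1 m).add
            (hF.integrable_exp_mul (-1) m)).const_mul 2) hpt
      _ ≤ 16 := by
          rw [integral_const_mul, integral_add (hF.integrable_exp_mul 1 m)
            (hF.integrable_exp_mul (-1) m)]
          linarith [hmgf 1 (by norm_num), hmgf (-1) (by norm_num)]
  have hexp : ∫ x, (F x - m) ^ 2 ∂(stdGaussian E) = ∫ x, F x ^ 2 ∂(stdGaussian E) - m ^ 2 := by
    have e : ∀ x, (F x - m) ^ 2 = F x ^ 2 - 2 * m * F x + m ^ 2 := fun x => by ring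
    simp only [e]
    have hi1 : Integrable (fun x => 2 * m * F x) (stdGaussian E) := hF.integrable.const_mul _
    have hi2 : Integrable (fun x => F x ^ 2 - 2 * m * F x) (stdGaussian E) := hsq.sub hi1
    rw [integral_add hi2 (integrable_const _), integral_sub hsq hi1, integral_const_mul, ← hm]
    simp
    ring
  linarith

/-- The upper tail around the root mean square, which dominates the mean. -/
theorem IsUnitSupport.measure_ge_le (hF : IsUnitSupport F) {ε : ℝ} (hε : 0 ≤ ε) :
    (stdGaussian E).real {x | √(∫ y, F y ^ 2 ∂(stdGaussian E)) + ε ≤ F x}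
      ≤ Real.exp (-ε ^ 2 / 5) := by
  set m := ∫ y, F y ∂(stdGaussian E) with hm
  have hm2 : m ≤ √(∫ y, F y ^ 2 ∂(stdGaussian E)) := by
    refine Real.le_sqrt_of_sq_le ?_
    have hv := variance_eq_sub hF.memLp_two
    have hv0 := variance_nonneg F (stdGaussian E)
    rw [hv] at hv0
    simpa [hm] using hv0
  have h := hF.hasSubgaussianMGF.measure_ge_le hε
  refine (measureReal_mono (fun x hx => ?_)).trans (h.trans (le_of_eq ?_))
  · simp only [Set.mem_ofPred_eq] at hx ⊢
    linarith
  · push_cast; congr 1; ring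

/-- The lower tail around the root mean square, which exceeds the mean by at most `4` because the
variance is at most `16`. -/
theorem IsUnitSupport.measure_le_le (hF : IsUnitSupport F) (hnn : ∀ x, 0 ≤ F x) {ε : ℝ}
    (hε : 0 ≤ ε) :
    (stdGaussian E).real {x | F x ≤ √(∫ y, F y ^ 2 ∂(stdGaussian E)) - ε - 4}
      ≤ Real.exp (-ε ^ 2 / 5) := by
  set m := ∫ y, F y ∂(stdGaussian E) with hm
  have hm0 : 0 ≤ m := integral_nonneg hnn
  have hm2 : √(∫ y, F y ^ 2 ∂(stdGaussian E)) ≤ m + 4 := by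
    rw [Real.sqrt_le_left (by linarith)]
    have := hF.integral_sq_le
    nlinarith
  have h := hF.hasSubgaussianMGF.neg.measure_ge_le hε
  refine (measureReal_mono (fun x hx => ?_)).trans (h.trans (le_of_eq ?_))
  · simp only [Set.mem_ofPred_eq, Pi.neg_apply] at hx ⊢
    linarith
  · push_cast; congr 1; ring

end Concentration

/-! ### The norm of the projection onto a cone -/

section Projection

open scoped RealInnerProductSpace

variable {n : ℕ}

theorem inner_sub_proj_le (K : ProperCone ℝ (EuclideanSpace ℝ (Fin n)))
    (v μ : EuclideanSpace ℝ (Fin n)) (hμ : μ ∈ K) : ⟪v - proj K v, μ - proj K v⟫ ≤ 0 := by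
  have hconv : Convex ℝ (K : Set (EuclideanSpace ℝ (Fin n))) := K.toPointedCone.convex
  refine (norm_eq_iInf_iff_real_inner_le_zero hconv (u := v) (proj_mem K v)).mp ?_ μ hμ
  have : Nonempty (K : Set (EuclideanSpace ℝ (Fin n))) := ⟨⟨0, K.zero_mem⟩⟩
  refine le_antisymm (le_ciInf fun w => norm_sub_proj_le K v w w.2) ?_
  exact ciInf_le (f := fun w : (K : Set (EuclideanSpace ℝ (Fin n))) => ‖v - w‖)
    ⟨0, by rintro _ ⟨w, rfl⟩; exact norm_nonneg _⟩ ⟨proj K v, proj_mem K v⟩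

theorem inner_proj_self (K : ProperCone ℝ (EuclideanSpace ℝ (Fin n)))
    (v : EuclideanSpace ℝ (Fin n)) : ⟪v, proj K v⟫ = ‖proj K v‖ ^ 2 := by
  have h0 := inner_sub_proj_le K v 0 K.zero_mem
  have h2 := inner_sub_proj_le K v ((2 : ℝ) • proj K v)
    (K.toPointedCone.smul_mem (show (0 : ℝ) ≤ 2 by norm_num) (proj_mem K v))
  have e2 : (2 : ℝ) • proj K v - proj K v = proj K v := by module
  rw [e2, inner_sub_left, real_inner_self_eq_norm_sq] at h2
  rw [zero_sub, inner_neg_right, inner_sub_left, real_inner_self_eq_norm_sq] at h0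
  linarith

theorem inner_le_norm_proj_mul (K : ProperCone ℝ (EuclideanSpace ℝ (Fin n)))
    (v μ : EuclideanSpace ℝ (Fin n)) (hμ : μ ∈ K) : ⟪v, μ⟫ ≤ ‖proj K v‖ * ‖μ‖ := by
  have h := inner_sub_proj_le K v (μ + proj K v) (K.add_mem hμ (proj_mem K v))
  rw [add_sub_cancel_right, inner_sub_left] at h
  linarith [real_inner_le_norm (proj K v) μ]

/-- If the projection does not vanish, its norm is attained by a unit vector of the cone. -/
theorem exists_norm_proj_eq_inner (K : ProperCone ℝ (EuclideanSpace ℝ (Fin n)))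
    (v : EuclideanSpace ℝ (Fin n)) (h : proj K v ≠ 0) :
    ∃ p ∈ K, ‖p‖ = 1 ∧ ‖proj K v‖ = ⟪v, p⟫ := by
  have h' : ‖proj K v‖ ≠ 0 := norm_ne_zero_iff.mpr h
  refine ⟨‖proj K v‖⁻¹ • proj K v, K.toPointedCone.smul_mem
    (show (0 : ℝ) ≤ ‖proj K v‖⁻¹ by positivity) (proj_mem K v), norm_smul_inv_norm h, ?_⟩
  rw [inner_smul_right, inner_proj_self]
  field_simp

theorem isUnitSupport_norm_proj (K : ProperCone ℝ (EuclideanSpace ℝ (Fin n))) :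
    IsUnitSupport fun v => ‖proj K v‖ := by
  intro z
  by_cases h : proj K z = 0
  · exact ⟨0, by simp, by simp [h], fun x => by simp⟩
  · obtain ⟨p, hpK, hp, hz⟩ := exists_norm_proj_eq_inner K z h
    refine ⟨p, hp.le, hz, fun x => ?_⟩
    simpa [hp] using inner_le_norm_proj_mul K x p hpK

/-- The unit vectors of a closed cone have finite nets. -/
theorem exists_finite_net (K : ProperCone ℝ (EuclideanSpace ℝ (Fin n))) {r : ℝ} (hr : 0 < r) :
    ∃ s : Finset (EuclideanSpace ℝ (Fin n)), (∀ u ∈ s, u ∈ K ∧ ‖u‖ = 1) ∧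
      ∀ u ∈ K, ‖u‖ = 1 → ∃ u' ∈ s, ‖u - u'‖ ≤ r := by
  have hc : IsCompact ((K : Set (EuclideanSpace ℝ (Fin n))) ∩ Metric.sphere 0 1) :=
    (isCompact_sphere 0 1).inter_left K.isClosed
  obtain ⟨t, hts, htf, hcov⟩ := Metric.finite_approx_of_totallyBounded hc.totallyBounded r hr
  refine ⟨htf.toFinset, fun u hu => ?_, fun u huK hu => ?_⟩
  · have := hts (htf.mem_toFinset.mp hu)
    exact ⟨this.1, by simpa using this.2⟩
  · have := hcov ⟨huK, by simpa using hu⟩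
    simp only [Set.mem_iUnion, Metric.mem_ball, dist_eq_norm, exists_prop] at this
    obtain ⟨u', hu', h⟩ := this
    exact ⟨u', htf.mem_toFinset.mpr hu', h.le⟩

end Projection

/-! ### Escape of a cone from a random linear map -/

section Escape

open scoped RealInnerProductSpace

variable {a b : ℕ}

/-- The rank one matrix `u vᵀ`, as a vector in the Euclidean space of matrices. -/
noncomputable def tensor (u : EuclideanSpace ℝ (Fin a)) (v : EuclideanSpace ℝ (Fin b)) :
    EuclideanSpace ℝ (Fin a × Fin b) :=
  WithLp.toLp 2 fun p => u p.1 * v p.2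

theorem inner_tensor (u : EuclideanSpace ℝ (Fin a)) (v : EuclideanSpace ℝ (Fin b))
    (Z : EuclideanSpace ℝ (Fin a × Fin b)) : ⟪tensor u v, Z⟫ = ∑ i, ∑ j, u i * v j * Z (i, j) := by
  simp only [tensor, PiLp.inner_apply, RCLike.inner_apply, conj_trivial, Fintype.sum_prod_type]
  exact Finset.sum_congr rfl fun i _ => Finset.sum_congr rfl fun j _ => mul_comm _ _

theorem inner_tensor_tensor (u u' : EuclideanSpace ℝ (Fin a)) (v v' : EuclideanSpace ℝ (Fin b)) :
    ⟪tensor u v, tensor u' v'⟫ = ⟪u, u'⟫ * ⟪v, v'⟫ := by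
  rw [inner_tensor]
  simp only [PiLp.inner_apply, RCLike.inner_apply, conj_trivial, Finset.sum_mul_sum, tensor]
  exact Finset.sum_congr rfl fun i _ => Finset.sum_congr rfl fun j _ => by ring

theorem norm_tensor (u : EuclideanSpace ℝ (Fin a)) (v : EuclideanSpace ℝ (Fin b)) :
    ‖tensor u v‖ = ‖u‖ * ‖v‖ := by
  have h := inner_tensor_tensor u u v v
  simp only [real_inner_self_eq_norm_sq, ← mul_pow] at h
  exact (sq_eq_sq₀ (norm_nonneg _) (by positivity)).mp h

theorem tensor_sub_left (u u' : EuclideanSpace ℝ (Fin a)) (v : EuclideanSpace ℝ (Fin b)) :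
    tensor (u - u') v = tensor u v - tensor u' v := by
  ext p
  simp [tensor, sub_mul]

/-- Gordon's inequality for the bilinear form of a Gaussian matrix: the process
`⟪u, Z v⟫ + γ` has covariances exceeding those of `-⟪u, g⟫ + ⟪v, h⟫` by
`(1 - ⟪u, u'⟫) (1 - ⟪v, v'⟫)`, which is nonnegative on unit vectors and vanishes if `u = u'`. -/
theorem gordon_bilinear {ι κ : Type*} [Fintype ι] [Fintype κ] (u : ι → EuclideanSpace ℝ (Fin a))
    (v : κ → EuclideanSpace ℝ (Fin b)) (hu : ∀ i, ‖u i‖ = 1) (hv : ∀ j, ‖v j‖ = 1) :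
    ((stdGaussian (EuclideanSpace ℝ (Fin a × Fin b))).prod (stdGaussian ℝ)).real
        {z | ∃ i, ∀ j, ⟪tensor (u i) (v j), z.1⟫ + z.2 ≤ 1}
      ≤ ((stdGaussian (EuclideanSpace ℝ (Fin a))).prod
          (stdGaussian (EuclideanSpace ℝ (Fin b)))).real
        {z | ∃ i, ∀ j, -⟪u i, z.1⟫ + ⟪v j, z.2⟫ ≤ 2} := by
  have h := gordon_comparison
    (integral_id_map_pairing (fun k : ι × κ => tensor (u k.1) (v k.2)) (fun _ => (1 : ℝ)))
    (integral_id_map_pairing (fun k : ι × κ => -u k.1) (fun k : ι × κ => v k.2)) ?_ ?_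
  · rw [map_measureReal_apply (by fun_prop) (measurableSet_exists_forall_le 1),
      map_measureReal_apply (by fun_prop) (measurableSet_exists_forall_le 2)] at h
    simpa using h
  · intro k l hkl
    rw [integral_mul_map_pairing, integral_mul_map_pairing, inner_tensor_tensor, hkl]
    simp [hu]
    ring
  · intro k l
    rw [integral_mul_map_pairing, integral_mul_map_pairing, inner_tensor_tensor]
    have h1 : ⟪u k.1, u l.1⟫ ≤ 1 := by simpa [hu] using real_inner_le_norm (u k.1) (u l.1)
    have h2 : ⟪v k.2, v l.2⟫ ≤ 1 := by simpa [hv] using real_inner_le_norm (v k.2) (v l.2)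
    simp
    nlinarith

theorem exists_measure_norm_ge_le {E : Type*} [NormedAddCommGroup E] [InnerProductSpace ℝ E]
    [FiniteDimensional ℝ E] [MeasurableSpace E] [BorelSpace E] {η : ℝ} (hη : 0 < η) :
    ∃ R₀ : ℝ, ∀ R, R₀ ≤ R → (stdGaussian E).real {z | R ≤ ‖z‖} ≤ η := by
  have hI : Integrable (fun z : E => ‖z‖) (stdGaussian E) := IsGaussian.integrable_id.norm
  refine ⟨max 1 ((∫ z, ‖z‖ ∂(stdGaussian E)) / η), fun R hR => ?_⟩
  have hR0 : 0 < R := lt_of_lt_of_le one_pos ((le_max_left _ _).trans hR)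
  have h := mul_meas_ge_le_integral_of_nonneg (ae_of_all _ fun z => norm_nonneg z) hI R
  have h2 := (div_le_iff₀ hη).mp ((le_max_right _ _).trans hR)
  exact le_of_mul_le_mul_left (h.trans h2) hR0

theorem half_le_measure_nonpos : 1 / 2 ≤ (stdGaussian ℝ).real {x | x ≤ 0} := by
  have hmap : (stdGaussian ℝ).map (LinearIsometryEquiv.neg ℝ) = stdGaussian ℝ := stdGaussian_map _
  have hm : MeasurableSet {x : ℝ | x ≤ 0} := measurableSet_Iic
  have e : (stdGaussian ℝ).real {x | 0 ≤ x} = (stdGaussian ℝ).real {x | x ≤ 0} := by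
    conv_rhs => rw [← hmap]
    rw [map_measureReal_apply (LinearIsometryEquiv.neg ℝ (E := ℝ)).continuous.measurable hm]
    congr 1
    ext x
    simp
  have hu : (stdGaussian ℝ).real ({x | x ≤ 0} ∪ {x | 0 ≤ x}) = 1 := by
    rw [show ({x : ℝ | x ≤ 0} ∪ {x | 0 ≤ x}) = Set.univ by ext x; simpa using le_total x 0]
    exact probReal_univ
  have := measureReal_union_le (μ := stdGaussian ℝ) {x : ℝ | x ≤ 0} {x | 0 ≤ x}
  linarith

theorem measureReal_prod_fst {α β : Type*} [MeasurableSpace α] [MeasurableSpace β] (μ : Measure α)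
    (ν : Measure β) [IsProbabilityMeasure μ] [IsProbabilityMeasure ν] (s : Set α) :
    (μ.prod ν).real {z | z.1 ∈ s} = μ.real s := by
  have : {z : α × β | z.1 ∈ s} = s ×ˢ Set.univ := by ext; simp
  rw [this, measureReal_prod_prod, probReal_univ, mul_one]

theorem measureReal_prod_snd {α β : Type*} [MeasurableSpace α] [MeasurableSpace β] (μ : Measure α)
    (ν : Measure β) [IsProbabilityMeasure μ] [IsProbabilityMeasure ν] (s : Set β) :
    (μ.prod ν).real {z | z.2 ∈ s} = ν.real s := by
  have : {z : α × β | z.2 ∈ s} = Set.univ ×ˢ s := by ext; simp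
  rw [this, measureReal_prod_prod, probReal_univ, one_mul]

variable (K₁ : ProperCone ℝ (EuclideanSpace ℝ (Fin a)))
  (K₂ : ProperCone ℝ (EuclideanSpace ℝ (Fin b)))

/-- The exceptional event, enlarged to a measurable set with the help of finite nets, is at most
twice as likely as the event that the projection of `h` onto `K₂` is not much longer than that of an
independent `g` onto `K₁`. -/
theorem exists_measurable_superset {η : ℝ} (hη : 0 < η) :
    ∃ S : Set (EuclideanSpace ℝ (Fin a × Fin b)), MeasurableSet S ∧
      (∀ Z, (∃ u ∈ K₁, ‖u‖ = 1 ∧ ∀ v ∈ K₂, ⟪tensor u v, Z⟫ ≤ 0) → Z ∈ S) ∧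
      (stdGaussian (EuclideanSpace ℝ (Fin a × Fin b))).real S
        ≤ 2 * ((stdGaussian (EuclideanSpace ℝ (Fin a))).prod
          (stdGaussian (EuclideanSpace ℝ (Fin b)))).real
            {z | ‖proj K₂ z.2‖ ≤ ‖proj K₁ z.1‖ + 3} + 3 * η := by
  obtain ⟨R₁, hR₁⟩ := exists_measure_norm_ge_le (E := EuclideanSpace ℝ (Fin a × Fin b)) hη
  obtain ⟨R₂, hR₂⟩ := exists_measure_norm_ge_le (E := EuclideanSpace ℝ (Fin b)) hη
  set R := max 1 (max R₁ R₂) with hR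
  have hR0 : 0 < R := lt_of_lt_of_le one_pos (le_max_left _ _)
  have hZ := hR₁ R ((le_max_left _ _).trans (le_max_right _ _))
  have hh := hR₂ R ((le_max_right _ _).trans (le_max_right _ _))
  obtain ⟨s, hs, hsnet⟩ := exists_finite_net K₁ (inv_pos.mpr hR0)
  obtain ⟨t, ht, htnet⟩ := exists_finite_net K₂ (inv_pos.mpr hR0)
  set T : Set (EuclideanSpace ℝ (Fin a × Fin b)) :=
    {Z | ∃ i : s, ∀ j : t, ⟪tensor (i : EuclideanSpace ℝ (Fin a)) j, Z⟫ ≤ 1} with hT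
  have hTm : MeasurableSet T := by
    have : T = ⋃ i : s, ⋂ j : t, {Z | ⟪tensor (i : EuclideanSpace ℝ (Fin a)) j, Z⟫ ≤ 1} := by
      ext; simp [hT]
    rw [this]
    exact MeasurableSet.iUnion fun i => MeasurableSet.iInter fun j =>
      measurableSet_le (by fun_prop) measurable_const
  refine ⟨{Z | R ≤ ‖Z‖} ∪ T, (measurableSet_le measurable_const measurable_norm).union hTm, ?_, ?_⟩
  · rintro Z ⟨u, huK, hu, hle⟩
    by_cases hZR : R ≤ ‖Z‖
    · exact Or.inl hZR
    refine Or.inr ?_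
    obtain ⟨u', hu', huu'⟩ := hsnet u huK hu
    refine ⟨⟨u', hu'⟩, fun j => ?_⟩
    obtain ⟨hjK, hj⟩ := ht j j.2
    have e : ⟪tensor u' (j : EuclideanSpace ℝ (Fin b)), Z⟫
        = ⟪tensor u j, Z⟫ - ⟪tensor (u - u') (j : EuclideanSpace ℝ (Fin b)), Z⟫ := by
      rw [tensor_sub_left, inner_sub_left]; ring
    have h1 : -⟪tensor (u - u') (j : EuclideanSpace ℝ (Fin b)), Z⟫ ≤ R⁻¹ * R := by
      refine (neg_le_abs _).trans ((abs_real_inner_le_norm _ _).trans ?_)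
      rw [norm_tensor, hj, mul_one]
      exact mul_le_mul huu' (not_le.mp hZR).le (norm_nonneg _) (inv_pos.mpr hR0).le
    rw [inv_mul_cancel₀ hR0.ne'] at h1
    show ⟪tensor u' (j : EuclideanSpace ℝ (Fin b)), Z⟫ ≤ 1
    rw [e]
    linarith [hle j hjK]
  · have hT2 : (stdGaussian (EuclideanSpace ℝ (Fin a × Fin b))).real T * (1 / 2)
        ≤ ((stdGaussian (EuclideanSpace ℝ (Fin a))).prod
          (stdGaussian (EuclideanSpace ℝ (Fin b)))).real
            {z | ‖proj K₂ z.2‖ ≤ ‖proj K₁ z.1‖ + 3} + η := by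
      calc (stdGaussian (EuclideanSpace ℝ (Fin a × Fin b))).real T * (1 / 2)
          ≤ (stdGaussian (EuclideanSpace ℝ (Fin a × Fin b))).real T
              * (stdGaussian ℝ).real {x | x ≤ 0} :=
            mul_le_mul_of_nonneg_left half_le_measure_nonpos measureReal_nonneg
        _ = ((stdGaussian (EuclideanSpace ℝ (Fin a × Fin b))).prod (stdGaussian ℝ)).real
              (T ×ˢ {x | x ≤ 0}) := (measureReal_prod_prod _ _).symm
        _ ≤ _ := measureReal_mono (by
            rintro ⟨Z, γ⟩ ⟨⟨i, hi⟩, hγ⟩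
            exact ⟨i, fun j => by linarith [hi j, show γ ≤ 0 from hγ]⟩)
        _ ≤ _ := gordon_bilinear (fun i : s => (i : EuclideanSpace ℝ (Fin a)))
              (fun j : t => (j : EuclideanSpace ℝ (Fin b))) (fun i => (hs i i.2).2)
              (fun j => (ht j j.2).2)
        _ ≤ ((stdGaussian (EuclideanSpace ℝ (Fin a))).prod
              (stdGaussian (EuclideanSpace ℝ (Fin b)))).real
            ({z | ‖proj K₂ z.2‖ ≤ ‖proj K₁ z.1‖ + 3} ∪ {z | z.2 ∈ {h | R ≤ ‖h‖}}) := by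
            refine measureReal_mono ?_
            rintro ⟨g, h⟩ ⟨i, hi⟩
            by_cases hhR : R ≤ ‖h‖
            · exact Or.inr hhR
            refine Or.inl ?_
            show ‖proj K₂ h‖ ≤ ‖proj K₁ g‖ + 3
            by_cases h0 : proj K₂ h = 0
            · rw [h0, norm_zero]; positivity
            obtain ⟨p, hpK, hp, hph⟩ := exists_norm_proj_eq_inner K₂ h h0
            obtain ⟨v, hv, hpv⟩ := htnet p hpK hp
            have h1 := hi ⟨v, hv⟩
            have h2 := inner_le_norm_proj_mul K₁ g i (hs i i.2).1
            rw [(hs i i.2).2, mul_one, real_inner_comm] at h2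
            have h3 : ⟪h, p - v⟫ ≤ R * R⁻¹ := (real_inner_le_norm _ _).trans
              (mul_le_mul (not_le.mp hhR).le hpv (norm_nonneg _) hR0.le)
            rw [mul_inv_cancel₀ hR0.ne', inner_sub_right, real_inner_comm v h] at h3
            simp only at h1
            rw [hph]
            linarith
        _ ≤ _ := (measureReal_union_le _ _).trans (by
            rw [measureReal_prod_snd]; linarith)
    linarith [measureReal_union_le (μ := stdGaussian (EuclideanSpace ℝ (Fin a × Fin b)))
      {Z | R ≤ ‖Z‖} T]

/-- The margin `17 √t` pays for two deviations `5 √t`, the offset `4` of the lower tail and the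
allowance `3`. -/
theorem measure_norm_proj_le {t : ℝ} (ht : 1 ≤ t)
    (h : √(statDim K₁) + 17 * √t ≤ √(statDim K₂)) :
    ((stdGaussian (EuclideanSpace ℝ (Fin a))).prod (stdGaussian (EuclideanSpace ℝ (Fin b)))).real
        {z | ‖proj K₂ z.2‖ ≤ ‖proj K₁ z.1‖ + 3} ≤ 2 * Real.exp (-(5 * t)) := by
  have ht1 : 1 ≤ √t := Real.one_le_sqrt.mpr ht
  have hε : 0 ≤ 5 * √t := by positivity
  have h1 := (isUnitSupport_norm_proj K₁).measure_ge_le hε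
  have h2 := (isUnitSupport_norm_proj K₂).measure_le_le (fun _ => norm_nonneg _) hε
  have e : -(5 * √t) ^ 2 / 5 = -(5 * t) := by
    rw [mul_pow, Real.sq_sqrt (by linarith)]; ring
  rw [e] at h1 h2
  rw [← measureReal_prod_fst _ (stdGaussian (EuclideanSpace ℝ (Fin b)))] at h1
  rw [← measureReal_prod_snd (stdGaussian (EuclideanSpace ℝ (Fin a)))] at h2
  refine (measureReal_mono ?_).trans ((measureReal_union_le _ _).trans
    ((add_le_add h1 h2).trans (by linarith)))
  rintro ⟨g, k⟩ hz
  simp only [Set.mem_union, Set.mem_ofPred_eq] at hz ⊢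
  by_contra hcon
  push Not at hcon
  unfold statDim at h
  linarith [hcon.1, hcon.2]

end Escape

/-! ### Standard Gaussian matrices -/

section RandomMatrix

open scoped RealInnerProductSpace

variable {Ω : Type*} [MeasurableSpace Ω] {P : Measure Ω} {m n a b : ℕ}

theorem IsStdGaussianMatrix.transpose {G : Ω → Matrix (Fin m) (Fin n) ℝ}
    (hG : IsStdGaussianMatrix P G) : IsStdGaussianMatrix P fun ω => (G ω)ᵀ where
  hasLaw i j := hG.hasLaw j i
  indep := hG.indep.precomp (g := Prod.swap) Prod.swap_injective

variable [IsProbabilityMeasure P]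

theorem IsStdGaussianMatrix.hasLaw_toLp {G : Ω → Matrix (Fin a) (Fin b) ℝ}
    (hG : IsStdGaussianMatrix P G) :
    HasLaw (fun ω => WithLp.toLp 2 fun p : Fin a × Fin b => G ω p.1 p.2)
      (stdGaussian (EuclideanSpace ℝ (Fin a × Fin b))) P := by
  have hm : AEMeasurable (fun ω (p : Fin a × Fin b) => G ω p.1 p.2) P :=
    aemeasurable_pi_lambda _ fun p => (hG.hasLaw p.1 p.2).aemeasurable
  have hL : Measurable (WithLp.toLp 2 : (Fin a × Fin b → ℝ) → _) := WithLp.measurable_toLp 2 _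
  refine ⟨hL.comp_aemeasurable hm, ?_⟩
  have h1 := (iIndepFun_iff_map_fun_eq_pi_map
    fun p : Fin a × Fin b => (hG.hasLaw p.1 p.2).aemeasurable).mp hG.indep
  simp only [(hG.hasLaw _ _).map_eq] at h1
  rw [← map_pi_eq_stdGaussian, ← h1, AEMeasurable.map_map_of_aemeasurable hL.aemeasurable hm]
  rfl

/-- **Escape theorem.** If `K₂` has sufficiently larger statistical dimension than `K₁`, then
with high probability the Gaussian matrix `G` sends no nonzero vector of `K₁` (acting from the left)
into the polar cone of `K₂`. -/
theorem IsStdGaussianMatrix.escape {G : Ω → Matrix (Fin a) (Fin b) ℝ}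
    (hG : IsStdGaussianMatrix P G) (K₁ : ProperCone ℝ (EuclideanSpace ℝ (Fin a)))
    (K₂ : ProperCone ℝ (EuclideanSpace ℝ (Fin b))) {t : ℝ} (ht : 1 ≤ t)
    (h : √(statDim K₁) + 17 * √t ≤ √(statDim K₂)) :
    P.real {ω | ∃ u ∈ K₁, u ≠ 0 ∧ ∀ v ∈ K₂, u.ofLp ⬝ᵥ (G ω *ᵥ v.ofLp) ≤ 0} ≤ Real.exp (-t) := by
  have hQ := measure_norm_proj_le K₁ K₂ ht h
  have hlim : ∀ η : ℝ, 0 < η →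
      P.real {ω | ∃ u ∈ K₁, u ≠ 0 ∧ ∀ v ∈ K₂, u.ofLp ⬝ᵥ (G ω *ᵥ v.ofLp) ≤ 0}
        ≤ Real.exp (-t) + η := by
    intro η hη
    obtain ⟨S, hSm, hS, hSle⟩ := exists_measurable_superset K₁ K₂ (η := η / 3) (by linarith)
    have hlaw := hG.hasLaw_toLp
    have h1 : P.real ((fun ω => WithLp.toLp 2 fun p : Fin a × Fin b => G ω p.1 p.2) ⁻¹' S)
        = (stdGaussian (EuclideanSpace ℝ (Fin a × Fin b))).real S := by
      rw [← hlaw.map_eq, Measure.real, Measure.real, Measure.map_apply_of_aemeasurable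
        hlaw.aemeasurable hSm]
    have h4 : 4 * Real.exp (-(5 * t)) ≤ Real.exp (-t) := by
      have e : Real.exp (-t) = Real.exp (4 * t) * Real.exp (-(5 * t)) := by
        rw [← Real.exp_add]; congr 1; ring
      rw [e]
      refine mul_le_mul_of_nonneg_right ?_ (Real.exp_nonneg _)
      linarith [Real.add_one_le_exp (4 * t)]
    refine (measureReal_mono ?_).trans (h1.le.trans (hSle.trans (by linarith)))
    rintro ω ⟨u, huK, hu, hle⟩
    refine hS _ ⟨‖u‖⁻¹ • u, K₁.toPointedCone.smul_mem
      (show (0 : ℝ) ≤ ‖u‖⁻¹ by positivity) huK, norm_smul_inv_norm hu, fun v hv => ?_⟩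
    have e : ⟪tensor (‖u‖⁻¹ • u) v, WithLp.toLp 2 fun p : Fin a × Fin b => G ω p.1 p.2⟫
        = ‖u‖⁻¹ * (u.ofLp ⬝ᵥ (G ω *ᵥ v.ofLp)) := by
      rw [inner_tensor]
      simp only [dotProduct, Matrix.mulVec, Finset.mul_sum, PiLp.smul_apply, smul_eq_mul]
      exact Finset.sum_congr rfl fun i _ => Finset.sum_congr rfl fun j _ => by ring
    rw [e]
    exact mul_nonpos_of_nonneg_of_nonpos (by positivity) (hle v hv)
  exact le_of_forall_pos_le_add hlim

/-! ### Statistical dimensions of a space and of a hyperplane -/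

theorem integral_norm_sq_stdGaussian :
    ∫ g, ‖g‖ ^ 2 ∂(stdGaussian (EuclideanSpace ℝ (Fin m))) = m := by
  have e : ∀ g : EuclideanSpace ℝ (Fin m), ‖g‖ ^ 2
      = ∑ i, ⟪EuclideanSpace.basisFun (Fin m) ℝ i, g⟫ * ⟪EuclideanSpace.basisFun (Fin m) ℝ i, g⟫ :=
    fun g => by
      rw [← (EuclideanSpace.basisFun (Fin m) ℝ).sum_sq_inner_right g]
      exact Finset.sum_congr rfl fun i _ => sq _
  simp only [e]
  have hI : ∀ i, MemLp (fun g => ⟪EuclideanSpace.basisFun (Fin m) ℝ i, g⟫) 2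
      (stdGaussian (EuclideanSpace ℝ (Fin m))) := fun i =>
    IsGaussian.memLp_dual _ (innerSL ℝ (EuclideanSpace.basisFun (Fin m) ℝ i)) 2 (by simp)
  have hI2 : ∀ i, Integrable (fun g => ⟪EuclideanSpace.basisFun (Fin m) ℝ i, g⟫
      * ⟪EuclideanSpace.basisFun (Fin m) ℝ i, g⟫) (stdGaussian (EuclideanSpace ℝ (Fin m))) :=
    fun i => (hI i).integrable_mul (hI i)
  rw [integral_finsetSum _ fun i _ => hI2 i]
  simp only [integral_inner_mul_inner_stdGaussian, real_inner_self_eq_norm_sq,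
    OrthonormalBasis.norm_eq_one]
  simp

theorem statDim_top : statDim (⊤ : ProperCone ℝ (EuclideanSpace ℝ (Fin m))) = m := by
  have h : ∀ v : EuclideanSpace ℝ (Fin m), proj ⊤ v = v := fun v =>
    (eq_proj ⊤ v v Submodule.mem_top (fun μ _ => by simp)).symm
  simp only [statDim, h, integral_norm_sq_stdGaussian]

/-- The hyperplane orthogonal to `w`, as a closed convex cone. -/
noncomputable def hyperplane (w : EuclideanSpace ℝ (Fin m)) :
    ProperCone ℝ (EuclideanSpace ℝ (Fin m)) :=
  halfCone (halfCone ⊤ w) (-w)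

theorem mem_hyperplane (w v : EuclideanSpace ℝ (Fin m)) : v ∈ hyperplane w ↔ ⟪w, v⟫ = 0 := by
  have ht : v ∈ (⊤ : ProperCone ℝ (EuclideanSpace ℝ (Fin m))) := Submodule.mem_top
  rw [hyperplane, mem_halfCone, mem_halfCone, inner_neg_left]
  constructor
  · rintro ⟨⟨-, h1⟩, h2⟩; linarith
  · intro h; exact ⟨⟨ht, h.ge⟩, by rw [h, neg_zero]⟩

theorem le_statDim_hyperplane {w : EuclideanSpace ℝ (Fin m)} (hw : w ≠ 0) :
    (m : ℝ) - 1 ≤ statDim (hyperplane w) := by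
  have hw' : ‖w‖ ^ 2 ≠ 0 := pow_ne_zero 2 (norm_ne_zero_iff.mpr hw)
  have hpt : ∀ v : EuclideanSpace ℝ (Fin m),
      ‖v‖ ^ 2 - (‖w‖ ^ 2)⁻¹ * (⟪w, v⟫ * ⟪w, v⟫) ≤ ‖proj (hyperplane w) v‖ ^ 2 := by
    intro v
    set μ := v - ((‖w‖ ^ 2)⁻¹ * ⟪w, v⟫) • w with hμ
    have hwμ : ⟪w, μ⟫ = 0 := by
      rw [hμ, inner_sub_right, inner_smul_right, real_inner_self_eq_norm_sq]
      field_simp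
      ring
    have hvμ : ⟪v, μ⟫ = ‖μ‖ ^ 2 := by
      have : v = μ + ((‖w‖ ^ 2)⁻¹ * ⟪w, v⟫) • w := by rw [hμ]; module
      nth_rewrite 1 [this]
      rw [inner_add_left, real_inner_smul_left, hwμ, mul_zero, add_zero, real_inner_self_eq_norm_sq]
    have hle := inner_le_norm_proj_mul (hyperplane w) v μ ((mem_hyperplane w μ).mpr hwμ)
    have hsq : ‖μ‖ ^ 2 = ‖v‖ ^ 2 - (‖w‖ ^ 2)⁻¹ * (⟪w, v⟫ * ⟪w, v⟫) := by
      rw [← hvμ, hμ, inner_sub_right, inner_smul_right, real_inner_self_eq_norm_sq,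
        real_inner_comm w v]
      ring
    rw [← hsq]
    rw [hvμ] at hle
    nlinarith [norm_nonneg μ, norm_nonneg (proj (hyperplane w) v), sq_nonneg (‖μ‖ -
      ‖proj (hyperplane w) v‖)]
  have hI1 : Integrable (fun v => ‖v‖ ^ 2) (stdGaussian (EuclideanSpace ℝ (Fin m))) := by
    simpa using (IsGaussian.memLp_two_id
      (μ := stdGaussian (EuclideanSpace ℝ (Fin m)))).norm.integrable_sq
  have hL : MemLp (fun v => ⟪w, v⟫) 2 (stdGaussian (EuclideanSpace ℝ (Fin m))) :=
    IsGaussian.memLp_dual _ (innerSL ℝ w) 2 (by simp)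
  have hI2 : Integrable (fun v => (‖w‖ ^ 2)⁻¹ * (⟪w, v⟫ * ⟪w, v⟫))
      (stdGaussian (EuclideanSpace ℝ (Fin m))) := (hL.integrable_mul hL).const_mul _
  have h := integral_mono (hI1.sub hI2)
    (isUnitSupport_norm_proj (hyperplane w)).memLp_two.integrable_sq hpt
  simp only [Pi.sub_apply] at h
  rw [integral_sub hI1 hI2, integral_const_mul, integral_norm_sq_stdGaussian,
    integral_inner_mul_inner_stdGaussian, real_inner_self_eq_norm_sq, inv_mul_cancel₀ hw'] at h
  exact h

/-! ### Kernel and image of a cone under a Gaussian matrix -/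

/-- Many measurements: no nonzero vector of the cone is sent into the line spanned by `c`. -/
theorem IsStdGaussianMatrix.measure_exists_mulVec_mem_line_le {G : Ω → Matrix (Fin m) (Fin n) ℝ}
    (hG : IsStdGaussianMatrix P G) (K : ProperCone ℝ (EuclideanSpace ℝ (Fin n))) {c : Fin m → ℝ}
    (hc : c ≠ 0) {t : ℝ} (ht : 1 ≤ t) (h : √(statDim K) + 17 * √t + 1 ≤ √(m : ℝ)) :
    P.real {ω | ∃ μ ∈ K, μ ≠ 0 ∧ ∃ s : ℝ, G ω *ᵥ μ.ofLp = s • c} ≤ Real.exp (-t) := by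
  set w : EuclideanSpace ℝ (Fin m) := WithLp.toLp 2 c with hw
  have hw0 : w ≠ 0 := fun h0 => hc (by simpa [hw] using h0)
  have hm : √(m : ℝ) ≤ √(statDim (hyperplane w)) + 1 := by
    refine (Real.sqrt_le_left (by positivity)).mpr ?_
    have h1 := le_statDim_hyperplane hw0
    have h2 : 0 ≤ statDim (hyperplane w) := integral_nonneg fun _ => sq_nonneg _
    have h3 := Real.sqrt_nonneg (statDim (hyperplane w))
    nlinarith [Real.sq_sqrt h2]
  refine (measureReal_mono ?_).trans (hG.transpose.escape K (hyperplane w) ht (by linarith))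
  rintro ω ⟨μ, hμK, hμ, s, hs⟩
  refine ⟨μ, hμK, hμ, fun v hv => le_of_eq ?_⟩
  rw [mem_hyperplane, hw, PiLp.inner_apply] at hv
  rw [Matrix.dotProduct_mulVec, Matrix.vecMul_transpose, hs, smul_dotProduct]
  simp only [RCLike.inner_apply, conj_trivial] at hv
  simp only [dotProduct, mul_comm (c _), hv, smul_zero]

/-- A convex cone that is not the whole space lies in a half-space, closed or not. -/
theorem exists_separating_of_ne_top {E : Type*} [NormedAddCommGroup E] [NormedSpace ℝ E]
    [FiniteDimensional ℝ E] (C : PointedCone ℝ E) {p : E} (hp : p ∉ C) :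
    ∃ f : StrongDual ℝ E, f ≠ 0 ∧ ∀ x ∈ C, f x ≤ 0 := by
  by_cases hint : (interior (C : Set E)).Nonempty
  · obtain ⟨f, hf, hle⟩ := geometric_hahn_banach_of_nonempty_interior_point C.convex
      (fun h => hp (interior_subset h)) hint
    refine ⟨f, hf, fun x hx => ?_⟩
    by_contra! hpos
    have h1 := hle _ (C.smul_mem (show (0 : ℝ) ≤ (|f p| + 1) / f x by positivity) hx)
    rw [map_smul, smul_eq_mul, div_mul_cancel₀ _ hpos.ne'] at h1
    linarith [le_abs_self (f p)]
  · have hspan : Submodule.span ℝ (C : Set E) ≠ ⊤ := by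
      intro htop
      refine hint (C.convex.interior_nonempty_iff_affineSpan_eq_top.mpr ?_)
      have h0 : insert (0 : E) (C : Set E) = C := Set.insert_eq_of_mem C.zero_mem
      rw [← AffineSubspace.coe_eq_univ_iff, ← h0, affineSpan_insert_zero, htop, Submodule.top_coe]
    obtain ⟨f, hf, hle⟩ := Submodule.exists_le_ker_of_lt_top _ (lt_top_iff_ne_top.mpr hspan)
    refine ⟨LinearMap.toContinuousLinearMap f, fun h => hf (by simpa using h), fun x hx => ?_⟩
    exact le_of_eq (LinearMap.mem_ker.mp (hle (Submodule.subset_span hx)))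

/-- Few measurements: the image of the cone is the whole space. -/
theorem IsStdGaussianMatrix.measure_not_surjective_le {G : Ω → Matrix (Fin m) (Fin n) ℝ}
    (hG : IsStdGaussianMatrix P G) (K : ProperCone ℝ (EuclideanSpace ℝ (Fin n)))
    {t : ℝ} (ht : 1 ≤ t) (h : √(m : ℝ) + 17 * √t ≤ √(statDim K)) :
    P.real {ω | ¬ ∀ y : Fin m → ℝ, ∃ μ ∈ K, G ω *ᵥ μ.ofLp = y} ≤ Real.exp (-t) := by
  rw [← statDim_top] at h
  refine (measureReal_mono ?_).trans (hG.escape ⊤ K ht h)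
  intro ω hω
  simp only [Set.mem_ofPred_eq, not_forall] at hω
  obtain ⟨y, hy⟩ := hω
  let L : EuclideanSpace ℝ (Fin n) →ₗ[ℝ] EuclideanSpace ℝ (Fin m) := Matrix.toEuclideanLin (G ω)
  obtain ⟨f, hf, hle⟩ := exists_separating_of_ne_top (K.toPointedCone.map L)
    (p := WithLp.toLp 2 y) (by
      rintro ⟨μ, hμ, hμy⟩
      exact hy ⟨μ, hμ, congrArg WithLp.ofLp hμy⟩)
  refine ⟨(InnerProductSpace.toDual ℝ _).symm f, Submodule.mem_top, by simpa using hf,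
    fun v hv => ?_⟩
  have h1 := hle (L v) ⟨v, hv, rfl⟩
  rw [← InnerProductSpace.toDual_symm_apply, PiLp.inner_apply] at h1
  refine le_trans (le_of_eq ?_) h1
  simp only [dotProduct, RCLike.inner_apply, conj_trivial]
  exact Finset.sum_congr rfl fun i _ => mul_comm _ _

end RandomMatrix

/-! ### Values of the conic program -/

section Values

variable {m n : ℕ} {x : EuclideanSpace ℝ (Fin n)} {K : ProperCone ℝ (EuclideanSpace ℝ (Fin n))}
  {A : Matrix (Fin m) (Fin n) ℝ}

/-- A feasible point of positive objective would be a nonzero element of `K_x`. -/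
theorem value_nonpos_of_forall_halfCone {b : Fin m → ℝ}
    (h : ∀ μ ∈ halfCone K x, μ ≠ 0 → A *ᵥ μ.ofLp ≠ b) : value x K A b ≤ 0 := by
  refine iSup₂_le fun μ hμ => ?_
  by_contra! hpos
  have hpos' : 0 < inner ℝ x μ := by exact_mod_cast hpos
  refine h μ ((mem_halfCone K x μ).mpr ⟨hμ.1, hpos'.le⟩) ?_ hμ.2
  rintro rfl
  simp at hpos'

theorem value_zero_eq_zero_of_forall_halfCone
    (h : ∀ μ ∈ halfCone K x, μ ≠ 0 → A *ᵥ μ.ofLp ≠ 0) : value x K A 0 = 0 := by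
  refine le_antisymm (value_nonpos_of_forall_halfCone h) ?_
  refine le_iSup₂_of_le (0 : EuclideanSpace ℝ (Fin n)) ⟨K.zero_mem, by simp⟩ ?_
  simp

/-- If `A` maps `K_x` onto the whole space, then every feasible point can be moved along a direction
of recession that increases the objective. -/
theorem value_eq_top_of_surjective (b : Fin m → ℝ) (hx : ∃ μ ∈ K, 0 < inner ℝ x μ)
    (h : ∀ y, ∃ μ ∈ halfCone K x, A *ᵥ μ.ofLp = y) : value x K A b = ⊤ := by
  obtain ⟨μ, hμK, hμ⟩ := hx
  obtain ⟨ν, hν, hνb⟩ := h b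
  obtain ⟨ξ, hξ, hξμ⟩ := h (-(A *ᵥ μ.ofLp))
  rw [mem_halfCone] at hν hξ
  rw [EReal.eq_top_iff_forall_lt]
  intro y
  set s := (|y| + 1) / inner ℝ x μ with hs
  have hs0 : 0 ≤ s := by positivity
  have hmem : ν + s • (μ + ξ) ∈ constraintSet K A b := by
    refine ⟨K.add_mem hν.1 (K.toPointedCone.smul_mem hs0 (K.add_mem hμK hξ.1)), ?_⟩
    rw [WithLp.ofLp_add, WithLp.ofLp_smul, WithLp.ofLp_add, Matrix.mulVec_add, Matrix.mulVec_smul,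
      Matrix.mulVec_add, hξμ, hνb, add_neg_cancel, smul_zero, add_zero]
  refine lt_of_lt_of_le ?_ (le_iSup₂_of_le _ hmem le_rfl)
  rw [EReal.coe_lt_coe_iff, inner_add_right, inner_smul_right, inner_add_right]
  have h1 : s * inner ℝ x μ = |y| + 1 := div_mul_cancel₀ _ hμ.ne'
  have h2 : 0 ≤ s * inner ℝ x ξ := mul_nonneg hs0 hξ.2
  rw [mul_add, h1]
  linarith [le_abs_self y, hν.2]

end Values

theorem one_sub_le_measureReal {Ω : Type*} [MeasurableSpace Ω] {P : Measure Ω}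
    [IsProbabilityMeasure P] {s u : Set Ω} {q : ℝ} (hu : P.real u ≤ q) (h : uᶜ ⊆ s) :
    1 - q ≤ P.real s := by
  have h1 := measureReal_union_le (μ := P) s u
  have h2 : s ∪ u = Set.univ := Set.eq_univ_of_forall fun ω => by
    by_cases hω : ω ∈ u
    · exact Or.inr hω
    · exact Or.inl (h hω)
  rw [h2, probReal_univ] at h1
  linarith

end ConicProgram

open ConicProgram in
theorem theorem1p4 :
    ∃ C : ℝ, 0 < C ∧
      ∀ (m n : ℕ), 0 < m → 0 < n →
      ∀ (x : EuclideanSpace ℝ (Fin n)), ‖x‖ = 1 →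
      ∀ (K : ProperCone ℝ (EuclideanSpace ℝ (Fin n))), (∃ μ ∈ K, μ ≠ 0) →
      ∀ (Ω : Type*) [MeasurableSpace Ω] (P : Measure Ω) [IsProbabilityMeasure P]
        (G : Ω → Matrix (Fin m) (Fin n) ℝ), ConicProgram.IsStdGaussianMatrix P G →
      ∀ t : ℝ, 1 ≤ t →
        -- homogeneous case
        ((√(m : ℝ) ≥ √(ConicProgram.statDim (ConicProgram.halfCone K x)) + C * √t →
            P.real {ω | ConicProgram.value x K (G ω) 0 = 0} ≥ 1 - Real.exp (-t)) ∧
         ((∃ μ ∈ K, 0 < inner ℝ x μ) →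
            √(m : ℝ) ≤ √(ConicProgram.statDim (ConicProgram.halfCone K x)) - C * √t →
            P.real {ω | ConicProgram.value x K (G ω) 0 = ⊤} ≥ 1 - Real.exp (-t))) ∧
        -- inhomogeneous case
        (∀ b : Fin m → ℝ, b ≠ 0 →
          (√(m : ℝ) ≥ √(ConicProgram.statDim K) + C * √t →
            P.real {ω | ¬ ConicProgram.Feasible K (G ω) b} ≥ 1 - Real.exp (-t)) ∧
          (√(ConicProgram.statDim (ConicProgram.halfCone K x)) + C * √t ≤ √(m : ℝ) →
            √(m : ℝ) ≤ √(ConicProgram.statDim K) - C * √t →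
            P.real {ω | ConicProgram.Feasible K (G ω) b ∧ ConicProgram.value x K (G ω) b ≤ 0}
              ≥ 1 - Real.exp (-t)) ∧
          ((∃ μ ∈ K, 0 < inner ℝ x μ) →
            √(m : ℝ) ≤ √(ConicProgram.statDim (ConicProgram.halfCone K x)) - C * √t →
            P.real {ω | ConicProgram.value x K (G ω) b = ⊤} ≥ 1 - Real.exp (-t))) := by
  -- `27 ≥ 17 * (3 / 2) + 1`: the factor `3 / 2 ≥ √2` serves to halve the failure probability, and
  -- the summand `1` covers the passage from `m` to the dimension `m - 1` of a hyperplane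
  refine ⟨27, by norm_num, ?_⟩
  intro m n hm _ x _ K _ Ω _ P _ G hG t ht
  have ht1 : 1 ≤ √t := Real.one_le_sqrt.mpr ht
  have htop : ∀ b : Fin m → ℝ, (∃ μ ∈ K, 0 < inner ℝ x μ) →
      √(m : ℝ) ≤ √(statDim (halfCone K x)) - 27 * √t →
      P.real {ω | value x K (G ω) b = ⊤} ≥ 1 - Real.exp (-t) := fun b hx h =>
    one_sub_le_measureReal (hG.measure_not_surjective_le (halfCone K x) ht (by linarith))
      fun ω hω => value_eq_top_of_surjective b hx (not_not.mp hω)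
  refine ⟨⟨fun h => ?_, htop 0⟩, fun b hb => ⟨fun h => ?_, fun h₁ h₂ => ?_, htop b⟩⟩
  · -- any line contains the origin, so an arbitrary nonzero vector serves here
    have hone : (1 : Fin m → ℝ) ≠ 0 := fun h1 => one_ne_zero (congrFun h1 ⟨0, hm⟩)
    refine one_sub_le_measureReal
      (hG.measure_exists_mulVec_mem_line_le (halfCone K x) hone ht (by linarith)) fun ω hω => ?_
    exact value_zero_eq_zero_of_forall_halfCone fun μ hμ hμ0 h0 =>
      hω ⟨μ, hμ, hμ0, 0, by rw [h0, zero_smul]⟩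
  · refine one_sub_le_measureReal
      (hG.measure_exists_mulVec_mem_line_le K hb ht (by linarith)) fun ω hω => ?_
    rintro ⟨μ, hμ, hμb⟩
    refine hω ⟨μ, hμ, ?_, 1, by rw [hμb, one_smul]⟩
    rintro rfl
    exact hb (by simpa using hμb.symm)
  · -- two exceptional events are discarded, each with probability at most `exp (-2 t)`
    have ht2 : 1 ≤ 2 * t := by linarith
    have hs2 : √(2 * t) ≤ 3 / 2 * √t := by
      rw [Real.sqrt_mul (by norm_num)]
      refine mul_le_mul_of_nonneg_right ?_ (Real.sqrt_nonneg _)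
      rw [Real.sqrt_le_left (by norm_num)]
      norm_num
    have hexp : Real.exp (-(2 * t)) + Real.exp (-(2 * t)) ≤ Real.exp (-t) := by
      have e : Real.exp (-t) = Real.exp t * Real.exp (-(2 * t)) := by
        rw [← Real.exp_add]; congr 1; ring
      rw [e, ← two_mul]
      refine mul_le_mul_of_nonneg_right ?_ (Real.exp_nonneg _)
      linarith [Real.add_one_le_exp t]
    have hA := hG.measure_exists_mulVec_mem_line_le (halfCone K x) hb ht2 (by linarith)
    have hB := hG.measure_not_surjective_le K ht2 (by linarith)
    refine one_sub_le_measureReal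
      ((measureReal_union_le _ _).trans ((add_le_add hA hB).trans hexp)) fun ω hω => ?_
    rw [Set.compl_union] at hω
    obtain ⟨μ, hμ, hμb⟩ := not_not.mp hω.2 b
    refine ⟨⟨μ, hμ, hμb⟩, value_nonpos_of_forall_halfCone fun ν hν hν0 h0 => ?_⟩
    exact hω.1 ⟨ν, hν, hν0, 1, by rw [h0, one_smul]⟩
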